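/- Let $d\ge 1$ and let $\gamma>0$, $\beta\ge 0$, $\theta\ge 1$, $a>0$, $\sigma^2>0$, $R_0>0$ and $p,\Delta^e\in\mathbb R$ satisfy $$\beta+2\le p<\frac{\theta+\gamma}{\beta+1}-\frac{2|\Delta^e|}{\sigma^2}.$$ Put $$q=\frac{(\theta+1)(\beta+2)}{\theta+\gamma+\beta+1},\qquad \zeta=\frac{\gamma+\beta}{\gamma+\beta+d(\beta+2)(\theta+1)},\qquad \varepsilon_0=(1-\zeta)\Big(\frac{\beta+2}{q}-1\Big).$$ Then there is a constant $C_L>0$, depending only on $d,\gamma,\beta,\theta,p,a,\sigma^2,\Delta^e,R_0$, with the following property. Let $U\subset\mathbb R^d$ be open and bounded, $T>0$, $r>2R_0$, let $u_0$ vanish outside the ball $B_{R_0}(0)$, and let $u\ge 0$ be a classical solution (continuous on $\overline U\times[0,T]$, with two continuous derivatives in $x$ and one continuous derivative in $t$ in $U\times(0,T]$) of $$\frac{\partial u}{\partial t}+\frac{\Delta^e}{a}u^\gamma|\nabla u|^\beta\sum_{i=1}^d\frac{\partial u}{\partial x_i}-\frac{\sigma^2}{2a}u^\gamma|\nabla u|^\beta\Delta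 u=0\quad\text{in }U\times(0,T],$$ $$u(x,0)=u_0(x)\ \text{ in } U,\qquad u=0\ \text{ on }\partial U\times(0,T).$$ For $n=0,1,2,\dots$ let $r_n=2r(1-2^{-(n+1)})$ and $U_n=U\setminus B_{r_n}(0)$, let $w=u^{(\theta+\gamma+\beta+1)/(\beta+2)}$, and let $$I_0(T)=\sup_{0<\tau<T}\int_{U_1}w^q\,dx+\int_0^T\!\!\int_{U_1}|\nabla w|^{\beta+2}\,dx\,d\tau .$$ If $$I_0(T)\le C_L^{-1/\varepsilon_0}\,2^{-(\beta+2)/\varepsilon_0^2}\,T^{-(\theta+1)/(\gamma+\beta)},$$ then for every $t\in[0,T]$ one has $w(x,t)=0$ for a.e. $x\in\bigcap_{n\ge 0}U_n$, and consequently $u(x,t)=0$ for a.e. $x\in U\setminus B_{2r}(0)$. -/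

import Mathlib

open Set MeasureTheory
open scoped ENNReal

namespace Localization

noncomputable section

/-- The class `C^{2,1}_{x,t}(U_T)`, `U_T = U × (0,T]`: functions continuous on `closure U × [0,T]`
with two continuous space derivatives and one continuous time derivative (one-sided at `t = T`)
in `U × (0,T]`. The derivatives are continuous jointly in `(x,t)`. -/
structure IsC21 {d : ℕ} (U : Set (EuclideanSpace ℝ (Fin d))) (T : ℝ)
    (u : EuclideanSpace ℝ (Fin d) → ℝ → ℝ) : Prop where
  continuousOn_closure :
    ContinuousOn (fun z : EuclideanSpace ℝ (Fin d) × ℝ => u z.1 z.2) (closure U ×ˢ Icc 0 T)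
  contDiffOn_space : ∀ t ∈ Ioc 0 T, ContDiffOn ℝ 2 (fun x => u x t) U
  continuousOn_fderiv :
    ContinuousOn (fun z : EuclideanSpace ℝ (Fin d) × ℝ => fderiv ℝ (fun y => u y z.2) z.1)
      (U ×ˢ Ioc 0 T)
  continuousOn_iteratedFDeriv_two :
    ContinuousOn
      (fun z : EuclideanSpace ℝ (Fin d) × ℝ => iteratedFDeriv ℝ 2 (fun y => u y z.2) z.1)
      (U ×ˢ Ioc 0 T)
  differentiableOn_time : ∀ x ∈ U, DifferentiableOn ℝ (u x) (Ioc 0 T)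
  continuousOn_derivWithin_time :
    ContinuousOn (fun z : EuclideanSpace ℝ (Fin d) × ℝ => derivWithin (u z.1) (Ioc 0 T) z.2)
      (U ×ˢ Ioc 0 T)

/-- `u ≥ 0` is a classical solution of
`u_t + (Δe / a) u^γ |∇u|^β ∑ᵢ ∂u/∂xᵢ - (σ² / 2a) u^γ |∇u|^β Δu = 0` in `U × (0,T]`,
`u(x,0) = u₀(x)` in `U`, and `u = 0` on `∂U × (0,T)`. -/
structure IsClassicalSolution {d : ℕ} (γ β a σ Δe : ℝ) (U : Set (EuclideanSpace ℝ (Fin d)))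
    (T : ℝ) (u₀ : EuclideanSpace ℝ (Fin d) → ℝ) (u : EuclideanSpace ℝ (Fin d) → ℝ → ℝ) :
    Prop where
  regular : IsC21 U T u
  nonneg : ∀ x ∈ U, ∀ t ∈ Icc 0 T, 0 ≤ u x t
  equation : ∀ x ∈ U, ∀ t ∈ Ioc 0 T,
    derivWithin (u x) (Ioc 0 T) t
      + Δe / a * u x t ^ γ * ‖gradient (fun y => u y t) x‖ ^ β
          * ∑ i : Fin d, fderiv ℝ (fun y => u y t) x (EuclideanSpace.single i 1)
      - σ ^ 2 / (2 * a) * u x t ^ γ * ‖gradient (fun y => u y t) x‖ ^ β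
          * Laplacian.laplacian (fun y => u y t) x = 0
  initial : ∀ x ∈ U, u x 0 = u₀ x
  boundary : ∀ x ∈ frontier U, ∀ t ∈ Ioo 0 T, u x t = 0

/-- The radii `r_n = 2r(1 - 1/2^{n+1})`. -/
def radius (r : ℝ) (n : ℕ) : ℝ := 2 * r * (1 - 1 / 2 ^ (n + 1))

/-- The sets `U_n = U \ B_{r_n}(0)`. -/
def outer {d : ℕ} (U : Set (EuclideanSpace ℝ (Fin d))) (r : ℝ) (n : ℕ) :
    Set (EuclideanSpace ℝ (Fin d)) :=
  U \ Metric.ball 0 (radius r n)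

/-- The transformed function `w = u^{(θ+γ+β+1)/(β+2)}`. -/
def wMap {d : ℕ} (γ β θ : ℝ) (u : EuclideanSpace ℝ (Fin d) → ℝ → ℝ) :
    EuclideanSpace ℝ (Fin d) → ℝ → ℝ :=
  fun x t => u x t ^ ((θ + γ + β + 1) / (β + 2))

/-- The exponent `q = (θ+1)(β+2)/(θ+γ+β+1)`. -/
def qExp (γ β θ : ℝ) : ℝ := (θ + 1) * (β + 2) / (θ + γ + β + 1)

/-- `I_n(t) = sup_{0<τ<t} ∫_{U_{n+1}} w^q dx + ∫₀ᵗ ∫_{U_{n+1}} |∇w|^{β+2} dx dτ`,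
with values in `[0,∞]`. -/
def energy {d : ℕ} (γ β θ : ℝ) (U : Set (EuclideanSpace ℝ (Fin d))) (r : ℝ)
    (u : EuclideanSpace ℝ (Fin d) → ℝ → ℝ) (n : ℕ) (t : ℝ) : ℝ≥0∞ :=
  (⨆ τ ∈ Ioo 0 t, ∫⁻ x in outer U r (n + 1), ENNReal.ofReal (wMap γ β θ u x τ ^ qExp γ β θ))
    + ∫⁻ τ in Ioo 0 t, ∫⁻ x in outer U r (n + 1),
        ENNReal.ofReal (‖gradient (fun y => wMap γ β θ u y τ) x‖ ^ (β + 2))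

/-- `ζ = (γ+β)/(γ+β+d(β+2)(θ+1))`. -/
def zetaExp (d : ℕ) (γ β θ : ℝ) : ℝ := (γ + β) / (γ + β + d * (β + 2) * (θ + 1))

/-- `ε₀ = (1-ζ)((β+2)/q - 1)`. -/
def epsZero (d : ℕ) (γ β θ : ℝ) : ℝ :=
  (1 - zetaExp d γ β θ) * ((β + 2) / qExp γ β θ - 1)

end

end Localization

namespace Localization

/-! ### Touching from above: first and second order conditions. -/

section Calculus

open Filter Topology
open scoped RealInnerProductSpace

/-! The argument is pointwise and does not iterate energies. Extended by zero, `u` becomes a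
continuous function `V` that vanishes initially on `‖x‖ ≥ R₀` and solves the equation where it is
positive, the drift being absorbed into an error `μ V^γ |∇V|^(β+1)`
(`IsClassicalSolution.degenerateFlow`). Of the energy only the supremum in time of `∫ w^q = ∫
u^(θ+1)` is needed. Two facts then suffice.

(1) An integral bound gives a sup bound (`exists_rpow_mul_pow_le`). At a maximum point of `V` times
a power of the distance to the boundary of the region, `V = h` at the centre of a ball on which `V ≤
Q h`. The measure estimate `DegenerateFlow.volume_closedBall_le` says that `V ≥ h / 2` on a fixed
fraction of that ball at some time, so Chebyshev's inequality bounds `h`. The estimate is of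
Alexandrov–Bakelman–Pucci type: slide `A |x - z|^α`, `α = (β+2)/(β+1)`, onto the graph of `V`. For
this `α` the vertex is `z = y - c |∇V|^β ∇V` at the contact point `y`. Touching bounds `|∇V|^β D²V`
above, and the equation bounds it below as long as `V_t` is not very negative, so contact points
occupy at least a fixed fraction of the measure of the vertices. A one-dimensional rising-sun
argument shows that `V_t` is not very negative for half of the times.

(2) A small flow on a ball with zero initial values vanishes at the centre
(`exists_extinction_threshold`), by comparison with `g(t) (|x - x₁|² + ε)^(m+1)`, where `g` solves
`g' = 2K g^(1+γ+β)`.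

Both thresholds scale with `T` as in the hypothesis. Together they give a constant `K` with `u = 0`
on `‖x‖ ≥ 2r` once the energy is at most `K T^(-(θ+1)/(γ+β))`, and `C_L = K^(-ε₀)` translates this
into the stated form. -/

theorem deriv_deriv_nonpos_of_isLocalMax {h : ℝ → ℝ} {a : ℝ} (hmax : IsLocalMax h a)
    (hc : ContinuousAt h a) : deriv (deriv h) a ≤ 0 := by
  by_contra! hpos
  -- A point that is both a local maximum and a local minimum has a neighbourhood where `h` is
  -- constant, which contradicts `h'' > 0`.
  have hmin : IsLocalMin h a := isLocalMin_of_deriv_deriv_pos hpos hmax.deriv_eq_zero hc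
  have heq : h =ᶠ[𝓝 a] fun _ => h a := by
    filter_upwards [hmax, hmin] with x hx hx' using le_antisymm hx hx'
  have h1 : deriv h =ᶠ[𝓝 a] fun _ => 0 := by
    have := heq.deriv
    simpa using this
  have h2 := h1.deriv_eq
  simp at h2
  linarith

variable {E : Type*} [NormedAddCommGroup E] [InnerProductSpace ℝ E]

/-- First and second order conditions at a point where a paraboloid touches `f` from above. -/
theorem fderiv_eq_and_hessian_le_of_touching {f : E → ℝ} {x y : E} {c : ℝ}
    (hf : ContDiffAt ℝ 2 f y)
    (htouch : ∀ᶠ y' in 𝓝 y, f y' ≤ f y + ⟪x, y' - y⟫ + c * ‖y' - y‖ ^ 2 / 2) (ξ : E) :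
    fderiv ℝ f y ξ = ⟪x, ξ⟫ ∧ fderiv ℝ (fderiv ℝ f) y ξ ξ ≤ c * ‖ξ‖ ^ 2 := by
  set h : ℝ → ℝ := fun s => f (y + s • ξ) - (s * ⟪x, ξ⟫ + s ^ 2 * (c * ‖ξ‖ ^ 2) / 2) with hh
  have hline : ∀ s : ℝ, HasDerivAt (fun s : ℝ => y + s • ξ) ξ s := fun s => by
    simpa using ((hasDerivAt_id s).smul_const ξ).const_add y
  have hcont : Tendsto (fun s : ℝ => y + s • ξ) (𝓝 0) (𝓝 y) := by
    have := (hline 0).continuousAt.tendsto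
    simpa using this
  have hmax : IsLocalMax h 0 := by
    filter_upwards [hcont.eventually htouch] with s hs
    simp only [hh, add_sub_cancel_left, inner_smul_right, norm_smul, mul_pow, Real.norm_eq_abs,
      sq_abs] at hs ⊢
    simp only [zero_smul, add_zero]
    linarith
  have hdiff : ∀ᶠ y' in 𝓝 y, DifferentiableAt ℝ f y' := by
    have := hf.eventually (by simp)
    filter_upwards [this] with y' hy' using hy'.differentiableAt (by simp)
  have hpoly : ∀ s : ℝ, HasDerivAt (fun s : ℝ => s * ⟪x, ξ⟫ + s ^ 2 * (c * ‖ξ‖ ^ 2) / 2)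
      (⟪x, ξ⟫ + s * (c * ‖ξ‖ ^ 2)) s := fun s => by
    have h1 := ((hasDerivAt_id s).mul_const ⟪x, ξ⟫).add
      ((((hasDerivAt_id s).pow 2).mul_const (c * ‖ξ‖ ^ 2)).div_const 2)
    refine h1.congr_deriv ?_
    simp only [id, Nat.cast_ofNat]
    ring
  have hderiv : ∀ᶠ s in 𝓝 (0 : ℝ), HasDerivAt h
      (fderiv ℝ f (y + s • ξ) ξ - (⟪x, ξ⟫ + s * (c * ‖ξ‖ ^ 2))) s := by
    filter_upwards [hcont.eventually hdiff] with s hs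
    exact (hs.hasFDerivAt.comp_hasDerivAt s (hline s)).sub (hpoly s)
  have hd0 := hderiv.self_of_nhds
  have hfirst : fderiv ℝ f y ξ - ⟪x, ξ⟫ = 0 := by
    have := hmax.hasDerivAt_eq_zero hd0
    simpa using this
  refine ⟨by linarith, ?_⟩
  have hdd : deriv h =ᶠ[𝓝 0]
      fun s => fderiv ℝ f (y + s • ξ) ξ - (⟪x, ξ⟫ + s * (c * ‖ξ‖ ^ 2)) := by
    filter_upwards [hderiv] with s hs using hs.deriv
  have hf' : DifferentiableAt ℝ (fderiv ℝ f) y :=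
    (hf.fderiv_right (m := 1) (by norm_num)).differentiableAt (by simp)
  have hsecond : HasDerivAt (fun s : ℝ => fderiv ℝ f (y + s • ξ) ξ - (⟪x, ξ⟫ + s * (c * ‖ξ‖ ^ 2)))
      (fderiv ℝ (fderiv ℝ f) y ξ ξ - c * ‖ξ‖ ^ 2) 0 := by
    have h1 : HasDerivAt (fun s : ℝ => fderiv ℝ f (y + s • ξ)) (fderiv ℝ (fderiv ℝ f) y ξ) 0 := by
      have hf'' : HasFDerivAt (fderiv ℝ f) (fderiv ℝ (fderiv ℝ f) y) (y + (0 : ℝ) • ξ) := by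
        simpa using hf'.hasFDerivAt
      exact hf''.comp_hasDerivAt 0 (hline 0)
    have h2 : HasDerivAt (fun s : ℝ => fderiv ℝ f (y + s • ξ) ξ)
        (fderiv ℝ (fderiv ℝ f) y ξ ξ) 0 := by
      simpa using h1.clm_apply (hasDerivAt_const (0 : ℝ) ξ)
    have h3 : HasDerivAt (fun s : ℝ => ⟪x, ξ⟫ + s * (c * ‖ξ‖ ^ 2)) (c * ‖ξ‖ ^ 2) 0 := by
      simpa using ((hasDerivAt_id (0 : ℝ)).mul_const (c * ‖ξ‖ ^ 2)).const_add ⟪x, ξ⟫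
    exact h2.sub h3
  have := deriv_deriv_nonpos_of_isLocalMax hmax hd0.continuousAt
  rw [hdd.deriv_eq, hsecond.deriv] at this
  linarith

theorem gradient_eq_and_hessian_le_of_touching [CompleteSpace E] {f : E → ℝ} {x y : E} {c : ℝ}
    (hf : ContDiffAt ℝ 2 f y)
    (htouch : ∀ᶠ y' in 𝓝 y, f y' ≤ f y + ⟪x, y' - y⟫ + c * ‖y' - y‖ ^ 2 / 2) :
    gradient f y = x ∧ ∀ ξ, fderiv ℝ (fderiv ℝ f) y ξ ξ ≤ c * ‖ξ‖ ^ 2 := by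
  refine ⟨ext_inner_right ℝ fun ξ => ?_,
    fun ξ => (fderiv_eq_and_hessian_le_of_touching hf htouch ξ).2⟩
  rw [inner_gradient_left, (fderiv_eq_and_hessian_le_of_touching hf htouch ξ).1]

/-- Writing `‖x + ξ‖² = ‖x‖² (1 + s)`, this is Bernoulli's inequality for the concave power `α / 2`.
It replaces the touching power by a touching paraboloid. -/
theorem norm_add_rpow_le_of_le_two {x : E} (hx : x ≠ 0) (ξ : E) {α : ℝ} (h0 : 0 ≤ α)
    (h2 : α ≤ 2) :
    ‖x + ξ‖ ^ α ≤ ‖x‖ ^ α + α * ‖x‖ ^ (α - 2) * (⟪x, ξ⟫ + ‖ξ‖ ^ 2 / 2) := by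
  have hx' : 0 < ‖x‖ := norm_pos_iff.2 hx
  set s : ℝ := (2 * ⟪x, ξ⟫ + ‖ξ‖ ^ 2) / ‖x‖ ^ 2 with hs
  have hsq : ‖x + ξ‖ ^ 2 = ‖x‖ ^ 2 * (1 + s) := by
    rw [norm_add_sq_real, hs]; field_simp; ring
  have hs1 : -1 ≤ s := by
    have : 0 ≤ ‖x‖ ^ 2 * (1 + s) := hsq ▸ sq_nonneg _
    have := nonneg_of_mul_nonneg_right this (by positivity)
    linarith
  have hb := rpow_one_add_le_one_add_mul_self hs1 (p := α / 2) (by linarith) (by linarith)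
  have key : ∀ w : ℝ, 0 ≤ w → w ^ α = (w ^ 2) ^ (α / 2) := fun w hw => by
    rw [← Real.rpow_natCast, ← Real.rpow_mul hw]; congr 1; push_cast; ring
  rw [key _ (norm_nonneg (x + ξ)), hsq, Real.mul_rpow (by positivity) (by linarith),
    ← key _ hx'.le, Real.rpow_sub hx', Real.rpow_two]
  calc ‖x‖ ^ α * (1 + s) ^ (α / 2) ≤ ‖x‖ ^ α * (1 + α / 2 * s) := by gcongr
    _ = _ := by rw [hs]; field_simp

/-- The exponent is chosen so that `φ = A |x - z|^α` has `|∇φ|^β ∇φ` linear in `x - z`; accordingly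
`|∇φ|^β D²φ` stays bounded although `D²φ` blows up at the vertex when `β > 0`. At the vertex itself
the gradient of `f` vanishes, so for `β > 0` the weight kills the Hessian term. -/
theorem norm_gradient_rpow_of_touching_rpow [CompleteSpace E] {f : E → ℝ} {y z : E} {A β : ℝ}
    (hA : 0 < A) (hβ : 0 ≤ β) (hf : ContDiffAt ℝ 2 f y)
    (htouch : ∀ᶠ y' in 𝓝 y, f y' ≤
      f y + A * (‖y' - z‖ ^ ((β + 2) / (β + 1)) - ‖y - z‖ ^ ((β + 2) / (β + 1)))) :
    ‖gradient f y‖ ^ β • gradient f y = (A * ((β + 2) / (β + 1))) ^ (β + 1) • (y - z) ∧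
    ∀ ξ, ‖gradient f y‖ ^ β * fderiv ℝ (fderiv ℝ f) y ξ ξ ≤
      (A * ((β + 2) / (β + 1))) ^ (β + 1) * ‖ξ‖ ^ 2 := by
  set α : ℝ := (β + 2) / (β + 1) with hα
  have hβ1 : 0 < β + 1 := by linarith
  have hα1 : 1 < α := by rw [hα, lt_div_iff₀ hβ1]; linarith
  have hα2 : α ≤ 2 := by rw [hα, div_le_iff₀ hβ1]; linarith
  have hαβ : (α - 1) * β = 2 - α := by rw [hα]; field_simp; ring
  have hD : 0 < A * α := by positivity
  by_cases hx : y - z = 0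
  · have hyz : y = z := sub_eq_zero.1 hx
    subst hyz
    rcases hβ.eq_or_lt with hβ0 | hβpos
    · subst hβ0
      have hα' : α = 2 := by rw [hα]; norm_num
      have ht : ∀ᶠ y' in 𝓝 y, f y' ≤ f y + ⟪(0 : E), y' - y⟫ + 2 * A * ‖y' - y‖ ^ 2 / 2 := by
        filter_upwards [htouch] with y' hy'
        rw [hα'] at hy'
        simp at hy' ⊢
        linarith
      obtain ⟨hg, h⟩ := gradient_eq_and_hessian_le_of_touching hf ht
      refine ⟨by simp [hg], fun ξ => ?_⟩
      have := h ξ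
      simp [hα'] at this ⊢
      linarith
    · have hg : gradient f y = 0 := by
        have hd : HasFDerivAt (fun y' => f y' - A * ‖y' - y‖ ^ α) (fderiv ℝ f y) y := by
          have h1 := (hf.differentiableAt (by simp)).hasFDerivAt
          have h2 : HasFDerivAt (fun y' : E => ‖y' - y‖ ^ α) (0 : E →L[ℝ] ℝ) y := by
            have h3 := hasFDerivAt_norm_rpow ((fun w : E => w - y) y) hα1
            refine (HasFDerivAt.comp (f := fun w : E => w - y) y h3
              ((hasFDerivAt_id y).sub_const y)).congr_fderiv ?_
            simp
          exact (h1.sub (h2.const_mul A)).congr_fderiv (by simp)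
        have hm : IsLocalMax (fun y' => f y' - A * ‖y' - y‖ ^ α) y := by
          filter_upwards [htouch] with y' hy'
          simp only [sub_self, norm_zero, Real.zero_rpow (show α ≠ 0 by linarith)] at hy' ⊢
          linarith
        have := hm.hasFDerivAt_eq_zero hd
        simp [gradient, this]
      refine ⟨by simp [hg], fun ξ => ?_⟩
      rw [hg, norm_zero, Real.zero_rpow hβpos.ne', zero_mul]
      positivity
  · set x := y - z with hxdef
    have hx' : 0 < ‖x‖ := norm_pos_iff.2 hx
    have ht : ∀ᶠ y' in 𝓝 y, f y' ≤
        f y + ⟪(A * α * ‖x‖ ^ (α - 2)) • x, y' - y⟫ +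
          (A * α * ‖x‖ ^ (α - 2)) * ‖y' - y‖ ^ 2 / 2 := by
      filter_upwards [htouch] with y' hy'
      have := norm_add_rpow_le_of_le_two hx (y' - y) (by linarith) hα2
      rw [show x + (y' - y) = y' - z by rw [hxdef]; abel] at this
      calc f y' ≤ _ := hy'
        _ ≤ f y + A * (α * ‖x‖ ^ (α - 2) * (⟪x, y' - y⟫ + ‖y' - y‖ ^ 2 / 2)) := by
          gcongr; linarith
        _ = _ := by rw [real_inner_smul_left]; ring
    obtain ⟨hg, h⟩ := gradient_eq_and_hessian_le_of_touching hf ht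
    have hng : ‖gradient f y‖ ^ β * (A * α * ‖x‖ ^ (α - 2)) = (A * α) ^ (β + 1) := by
      rw [hg, norm_smul, Real.norm_of_nonneg (by positivity), mul_assoc, ← Real.rpow_add_one hx'.ne',
        Real.mul_rpow hD.le (by positivity), ← Real.rpow_mul hx'.le,
        show (α - 2 + 1) * β = 2 - α by rw [← hαβ]; ring, Real.rpow_add hD, Real.rpow_one]
      have : ‖x‖ ^ (2 - α) * ‖x‖ ^ (α - 2) = 1 := by
        rw [← Real.rpow_add hx']; simp
      linear_combination (A * α) ^ β * (A * α) * this
    refine ⟨?_, fun ξ => ?_⟩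
    · nth_rewrite 2 [hg]
      rw [smul_smul, hng]
    · calc _ ≤ ‖gradient f y‖ ^ β * (A * α * ‖x‖ ^ (α - 2) * ‖ξ‖ ^ 2) := by
            gcongr; exact h ξ
        _ = _ := by rw [← hng]; ring

end Calculus

/-! ### Weighted Hessian bounds, the vertex map and the volume of its image. -/

section Hessian

open Filter Topology Module
open scoped RealInnerProductSpace

variable {E : Type*} [NormedAddCommGroup E] [InnerProductSpace ℝ E]

theorem exists_hasFDerivAt_norm_rpow_smul {β : ℝ} (hβ : 0 ≤ β) (p : E) :
    ∃ F' : E →L[ℝ] E, HasFDerivAt (fun p : E => ‖p‖ ^ β • p) F' p ∧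
      ‖F'‖ ≤ (1 + β) * ‖p‖ ^ β := by
  rcases hβ.eq_or_lt with rfl | hβpos
  · refine ⟨ContinuousLinearMap.id ℝ E, ?_, ?_⟩
    · simpa only [Real.rpow_zero, one_smul] using! hasFDerivAt_id p
    · simpa using ContinuousLinearMap.norm_id_le
  by_cases hp : p = 0
  · subst hp
    refine ⟨0, ?_, by simp [Real.zero_rpow hβpos.ne']⟩
    rw [hasFDerivAt_iff_isLittleO_nhds_zero]
    have h1 : (fun p : E => ‖p‖ ^ β) =o[𝓝 0] fun _ => (1 : ℝ) := by
      rw [Asymptotics.isLittleO_one_iff]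
      have : Continuous fun p : E => ‖p‖ ^ β := continuous_norm.rpow_const fun _ => Or.inr hβ
      simpa [Real.zero_rpow hβpos.ne'] using this.tendsto 0
    have h2 := h1.smul_isBigO (Asymptotics.isBigO_refl (fun p : E => p) (𝓝 0))
    simpa using h2
  · have hn : 0 < ‖p‖ := norm_pos_iff.2 hp
    have h1 : HasFDerivAt (fun p : E => ‖p‖ ^ 2) (2 • innerSL ℝ p) p :=
      (hasStrictFDerivAt_norm_sq p).hasFDerivAt
    have h2 := h1.rpow_const (p := β / 2) (Or.inl (by positivity))
    have hkey : ∀ s : ℝ, ∀ w : E, (‖w‖ ^ 2) ^ s = ‖w‖ ^ (2 * s) := fun s w => by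
      rw [← Real.rpow_natCast, ← Real.rpow_mul (norm_nonneg _)]; norm_num
    have h3 : HasFDerivAt (fun w : E => ‖w‖ ^ β)
        ((β / 2 * (‖p‖ ^ 2) ^ (β / 2 - 1)) • (2 • innerSL ℝ p)) p := by
      refine h2.congr_of_eventuallyEq (Eventually.of_forall fun w => ?_)
      simp only [hkey]; congr 1; ring
    have h4 := h3.smul (hasFDerivAt_id p)
    refine ⟨_, h4, ?_⟩
    refine (norm_add_le _ _).trans ?_
    rw [add_mul, one_mul]
    refine add_le_add ?_ ?_
    · rw [norm_smul, Real.norm_of_nonneg (by positivity)]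
      exact mul_le_of_le_one_right (by positivity) ContinuousLinearMap.norm_id_le
    · rw [ContinuousLinearMap.norm_smulRight_apply, norm_smul, Real.norm_of_nonneg (by positivity),
        hkey, two_nsmul, ← two_smul ℝ, norm_smul, innerSL_apply_norm]
      have : ‖p‖ ^ β = ‖p‖ ^ (2 * (β / 2 - 1)) * ‖p‖ * ‖p‖ := by
        rw [← Real.rpow_add_one hn.ne', ← Real.rpow_add_one hn.ne']; congr 1; ring
      simp only [id, Real.norm_ofNat]
      rw [this]
      apply le_of_eq; ring

variable [FiniteDimensional ℝ E]

theorem laplacian_eq_sum_fderiv_fderiv {ι : Type*} [Fintype ι] (b : OrthonormalBasis ι ℝ E)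
    (f : E → ℝ) (y : E) :
    Laplacian.laplacian f y = ∑ i, fderiv ℝ (fderiv ℝ f) y (b i) (b i) := by
  rw [InnerProductSpace.laplacian_eq_iteratedFDeriv_orthonormalBasis f b]
  simp [iteratedFDeriv_two_apply]

/-- A symmetric bilinear form which is bounded above and whose trace is bounded below is
bounded. -/
theorem opNorm_le_of_le_of_trace_ge {B : E →L[ℝ] E →L[ℝ] ℝ} (hsymm : ∀ u v, B u v = B v u)
    {c m : ℝ} (hc : 0 ≤ c) (hm : 0 ≤ m) (hle : ∀ ξ, B ξ ξ ≤ c * ‖ξ‖ ^ 2)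
    (htr : ∀ b : OrthonormalBasis (Fin (finrank ℝ E)) ℝ E, -m ≤ ∑ i, B (b i) (b i)) :
    ‖B‖ ≤ m + finrank ℝ E * c := by
  classical
  set K : ℝ := m + finrank ℝ E * c with hK
  have hK0 : 0 ≤ K := by positivity
  -- Complete `e` to an orthonormal basis: the other diagonal entries are at most `c`, so the trace
  -- bound leaves `B e e` bounded below.
  have hunit : ∀ e : E, ‖e‖ = 1 → -K ≤ B e e := by
    intro e he
    have hpos : 0 < finrank ℝ E := by
      rw [finrank_pos_iff_exists_ne_zero]
      exact ⟨e, fun h => by simp [h] at he⟩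
    let i₀ : Fin (finrank ℝ E) := ⟨0, hpos⟩
    have ho : Orthonormal ℝ (({i₀} : Set (Fin (finrank ℝ E))).domRestrict fun _ => e) :=
      ⟨fun _ => he, fun i j hij => absurd (Subsingleton.elim i j) hij⟩
    obtain ⟨b, hb⟩ := ho.exists_orthonormalBasis_extension_of_card_eq (by simp)
    have hbe : b i₀ = e := hb i₀ rfl
    have h1 := htr b
    rw [← Finset.add_sum_erase _ _ (Finset.mem_univ i₀), hbe] at h1
    have h2 : ∑ i ∈ Finset.univ.erase i₀, B (b i) (b i) ≤ finrank ℝ E * c := by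
      calc _ ≤ ∑ i ∈ Finset.univ.erase i₀, c := Finset.sum_le_sum fun i _ => by
              simpa using hle (b i)
        _ ≤ ∑ i : Fin (finrank ℝ E), c :=
              Finset.sum_le_sum_of_subset_of_nonneg (Finset.erase_subset _ _) fun _ _ _ => hc
        _ = _ := by simp
    linarith
  have hlow : ∀ ξ : E, -(K * ‖ξ‖ ^ 2) ≤ B ξ ξ := by
    intro ξ
    by_cases hξ : ξ = 0
    · simp [hξ]
    have hn : 0 < ‖ξ‖ := norm_pos_iff.2 hξ
    have h1 := hunit (‖ξ‖⁻¹ • ξ) (by rw [norm_smul, norm_inv, norm_norm, inv_mul_cancel₀ hn.ne'])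
    simp only [map_smul, smul_apply, smul_eq_mul] at h1
    have h2 : B ξ ξ = ‖ξ‖ ^ 2 * (‖ξ‖⁻¹ * (‖ξ‖⁻¹ * B ξ ξ)) := by field_simp
    rw [h2]
    nlinarith [sq_nonneg ‖ξ‖]
  have hhigh : ∀ ξ : E, B ξ ξ ≤ K * ‖ξ‖ ^ 2 := by
    intro ξ
    by_cases hξ : ξ = 0
    · simp [hξ]
    have hpos : (1 : ℝ) ≤ finrank ℝ E := by
      have : 0 < finrank ℝ E := finrank_pos_iff_exists_ne_zero.2 ⟨ξ, hξ⟩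
      exact_mod_cast this
    refine (hle ξ).trans ?_
    gcongr
    nlinarith
  have habs : ∀ u v : E, |B u v| ≤ K * (‖u‖ ^ 2 + ‖v‖ ^ 2) / 2 := by
    intro u v
    have h1 : 4 * B u v = B (u + v) (u + v) - B (u - v) (u - v) := by
      simp only [map_add, map_sub, add_apply, sub_apply]
      rw [hsymm v u]; ring
    have hp : ‖u + v‖ ^ 2 + ‖u - v‖ ^ 2 = 2 * (‖u‖ ^ 2 + ‖v‖ ^ 2) := by
      have := parallelogram_law_with_norm ℝ u v
      linarith
    have hp' : K * ‖u + v‖ ^ 2 + K * ‖u - v‖ ^ 2 = 2 * (K * (‖u‖ ^ 2 + ‖v‖ ^ 2)) := by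
      rw [← mul_add, hp]; ring
    rw [abs_le]
    constructor
    · linarith [hlow (u + v), hhigh (u - v)]
    · linarith [hlow (u - v), hhigh (u + v)]
  refine ContinuousLinearMap.opNorm_le_bound₂ _ hK0 fun u v => ?_
  by_cases hu : u = 0
  · simp [hu]
  by_cases hv : v = 0
  · simp [hv]
  have hu' : 0 < ‖u‖ := norm_pos_iff.2 hu
  have hv' : 0 < ‖v‖ := norm_pos_iff.2 hv
  -- Rescaled to equal norms, the two vectors turn the sum of squares into a product.
  have h := habs (‖v‖ • u) (‖u‖ • v)
  simp only [map_smul, smul_apply, smul_eq_mul, norm_smul, norm_norm,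
    abs_mul, abs_norm] at h
  rw [Real.norm_eq_abs]
  have h3 : ‖u‖ * ‖v‖ * |B u v| ≤ ‖u‖ * ‖v‖ * (K * ‖u‖ * ‖v‖) := by linarith
  exact le_of_mul_le_mul_left h3 (by positivity)

/-- The weight will be `|∇V|^β`, which may vanish, so every bound has to be stated for the weighted
form. -/
theorem mul_opNorm_le_of_le_of_trace_ge {B : E →L[ℝ] E →L[ℝ] ℝ}
    (hsymm : ∀ u v, B u v = B v u) {c m w : ℝ} (hw : 0 ≤ w) (hc : 0 ≤ c) (hm : 0 ≤ m)
    (hle : ∀ ξ, w * B ξ ξ ≤ c * ‖ξ‖ ^ 2)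
    (htr : ∀ b : OrthonormalBasis (Fin (finrank ℝ E)) ℝ E, -m ≤ w * ∑ i, B (b i) (b i)) :
    w * ‖B‖ ≤ m + finrank ℝ E * c := by
  rcases hw.eq_or_lt with rfl | hw
  · rw [zero_mul]; positivity
  have h := opNorm_le_of_le_of_trace_ge hsymm (c := c / w) (m := m / w) (by positivity)
    (by positivity) (fun ξ => by rw [div_mul_eq_mul_div, le_div_iff₀' hw]; exact hle ξ)
    (fun b => by rw [← neg_div, div_le_iff₀' hw]; exact htr b)
  calc w * ‖B‖ ≤ w * (m / w + finrank ℝ E * (c / w)) := by gcongr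
    _ = _ := by field_simp

theorem exists_hasFDerivAt_gradient {f : E → ℝ} {y : E} (hf : ContDiffAt ℝ 2 f y) :
    ∃ G' : E →L[ℝ] E, HasFDerivAt (gradient f) G' y ∧ ‖G'‖ ≤ ‖fderiv ℝ (fderiv ℝ f) y‖ := by
  let J : (E →L[ℝ] ℝ) →ₗᵢ[ℝ] E :=
    { toFun := (InnerProductSpace.toDual ℝ E).symm
      map_add' := by simp
      map_smul' := by simp
      norm_map' := by simp }
  have hf' : DifferentiableAt ℝ (fderiv ℝ f) y :=
    (hf.fderiv_right (m := 1) (by norm_num)).differentiableAt (by simp)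
  refine ⟨J.toContinuousLinearMap.comp (fderiv ℝ (fderiv ℝ f) y),
    J.toContinuousLinearMap.hasFDerivAt.comp y hf'.hasFDerivAt, ?_⟩
  refine (ContinuousLinearMap.opNorm_comp_le _ _).trans ?_
  exact mul_le_of_le_one_left (norm_nonneg _) J.norm_toContinuousLinearMap_le

/-- The map `y ↦ y - c |∇f|^β ∇f`, which recovers the vertex of a touching function
`A |x - z|^((β+2)/(β+1))` from its contact point. -/
theorem exists_hasFDerivAt_vertexMap {f : E → ℝ} {y : E} (hf : ContDiffAt ℝ 2 f y) {c β : ℝ}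
    (hc : 0 ≤ c) (hβ : 0 ≤ β) :
    ∃ Z' : E →L[ℝ] E,
      HasFDerivAt (fun y => y - c • (‖gradient f y‖ ^ β • gradient f y)) Z' y ∧
      ‖Z'‖ ≤ 1 + (1 + β) * (c * (‖gradient f y‖ ^ β * ‖fderiv ℝ (fderiv ℝ f) y‖)) := by
  obtain ⟨G', hG, hGn⟩ := exists_hasFDerivAt_gradient hf
  obtain ⟨F', hF, hFn⟩ := exists_hasFDerivAt_norm_rpow_smul hβ (gradient f y)
  refine ⟨ContinuousLinearMap.id ℝ E - c • F'.comp G',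
    (hasFDerivAt_id y).sub ((hF.comp y hG).const_smul c), ?_⟩
  refine (norm_sub_le _ _).trans (add_le_add ContinuousLinearMap.norm_id_le ?_)
  rw [norm_smul, Real.norm_of_nonneg hc]
  calc c * ‖F'.comp G'‖ ≤ c * (‖F'‖ * ‖G'‖) := by
        gcongr; exact ContinuousLinearMap.opNorm_comp_le _ _
    _ ≤ c * (((1 + β) * ‖gradient f y‖ ^ β) * ‖fderiv ℝ (fderiv ℝ f) y‖) := by gcongr
    _ = _ := by ring

variable [MeasurableSpace E] [BorelSpace E]

/-- The image of the unit ball lies in the ball of radius `‖L‖`; compare volumes. -/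
theorem abs_det_le_norm_pow (L : E →L[ℝ] E) : |L.det| ≤ ‖L‖ ^ finrank ℝ E := by
  let μ : Measure E := volume
  have hb0 : μ (Metric.closedBall 0 1) ≠ 0 := (Metric.measure_closedBall_pos μ 0 one_pos).ne'
  have hbt : μ (Metric.closedBall 0 1) ≠ ∞ := measure_closedBall_lt_top.ne
  have h1 : μ (L '' Metric.closedBall 0 1) ≤ μ (Metric.closedBall 0 ‖L‖) := by
    refine measure_mono ?_
    rintro _ ⟨v, hv, rfl⟩
    rw [mem_closedBall_zero_iff] at hv ⊢
    exact (L.le_opNorm v).trans (mul_le_of_le_one_right (norm_nonneg _) hv)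
  rw [Measure.addHaar_image_continuousLinearMap, Measure.addHaar_closedBall' _ _ (norm_nonneg _),
    ENNReal.mul_le_mul_iff_left hb0 hbt, ENNReal.ofReal_le_ofReal_iff (by positivity)] at h1
  exact h1

theorem volume_image_le_of_norm_hasFDerivAt_le {Z : E → E} {s : Set E} (hs : MeasurableSet s)
    {C : ℝ} (hZ : ∀ y ∈ s, ∃ Z' : E →L[ℝ] E, HasFDerivAt Z Z' y ∧ ‖Z'‖ ≤ C) :
    volume (Z '' s) ≤ ENNReal.ofReal (C ^ finrank ℝ E) * volume s := by
  choose! Z' hd hn using hZ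
  refine (addHaar_image_le_lintegral_abs_det_fderiv volume hs
    fun y hy => (hd y hy).hasFDerivWithinAt).trans ?_
  rw [← setLIntegral_const]
  refine setLIntegral_mono measurable_const fun y hy => ENNReal.ofReal_le_ofReal ?_
  exact (abs_det_le_norm_pow _).trans (pow_le_pow_left₀ (norm_nonneg _) (hn y hy) _)

end Hessian

/-! ### Functions of time with one-sided slope bounds. -/

section OneSidedSlopes

open Filter Topology

theorem le_of_hasDerivWithinAt_Iic {v : ℝ → ℝ} {s t m : ℝ} (hv : HasDerivWithinAt v s (Iic t) t)
    (h : ∀ᶠ t' in 𝓝[<] t, m * (t - t') ≤ v t - v t') : m ≤ s := by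
  have h1 : Tendsto (slope v t) (𝓝[<] t) (𝓝 s) := by
    have := hasDerivWithinAt_iff_tendsto_slope.1 hv
    rwa [Iic_sdiff_right] at this
  refine ge_of_tendsto h1 ?_
  filter_upwards [h, self_mem_nhdsWithin] with t' ht' hlt
  rw [mem_Iio] at hlt
  rw [slope_comm, slope_def_field, le_div_iff₀ (by linarith)]
  exact ht'

/-- A bound on all lower left slopes gives a one-sided Lipschitz bound. -/
theorem sub_le_of_left_slope_le {f : ℝ → ℝ} {a b C : ℝ} (hab : a ≤ b)
    (hf : ContinuousOn f (Icc a b))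
    (h : ∀ r ∈ Ioc a b, ∀ m : ℝ, (∀ᶠ r' in 𝓝[<] r, m * (r - r') ≤ f r - f r') → m ≤ C) :
    f b - f a ≤ C * (b - a) := by
  rcases hab.eq_or_lt with rfl | hlt
  · simp
  by_contra! hcon
  -- With `C'` strictly between `C` and the mean slope, `f r - C' r` has its maximum away from `a`,
  -- and there the left slopes of `f` are at least `C' > C`.
  obtain ⟨C', hC, hC'⟩ : ∃ C', C < C' ∧ C' * (b - a) < f b - f a := by
    have h1 : C < (f b - f a) / (b - a) := by rw [lt_div_iff₀ (by linarith)]; exact hcon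
    obtain ⟨C', h2, h3⟩ := exists_between h1
    exact ⟨C', h2, by rwa [lt_div_iff₀ (by linarith)] at h3⟩
  have hcont : ContinuousOn (fun r => f r - C' * r) (Icc a b) := by fun_prop
  obtain ⟨r, hr, hmax⟩ := isCompact_Icc.exists_isMaxOn (nonempty_Icc.2 hab) hcont
  have hra : a < r := by
    refine lt_of_le_of_ne hr.1 ?_
    rintro rfl
    have := hmax (right_mem_Icc.2 hab)
    simp only [mem_ofPred_eq] at this
    linarith
  refine hC.not_ge (h r ⟨hra, hr.2⟩ C' ?_)
  filter_upwards [Ioo_mem_nhdsLT hra] with r' hr'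
  have := hmax (show r' ∈ Icc a b from ⟨hr'.1.le, hr'.2.le.trans hr.2⟩)
  simp only [mem_ofPred_eq] at this
  linarith

/-- If the left slopes of `f` are at most `C` and are below `-L` outside of `s`, then `s` cannot
be small unless `f` decreases a lot. -/
theorem ofReal_sub_add_le_mul_volume {f : ℝ → ℝ} {a b C L : ℝ} {s : Set ℝ} (hab : a ≤ b)
    (hCL : 0 ≤ C + L) (hf : ContinuousOn f (Icc a b))
    (hC : ∀ r ∈ Ioc a b, ∀ m : ℝ, (∀ᶠ r' in 𝓝[<] r, m * (r - r') ≤ f r - f r') → m ≤ C)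
    (hs : ∀ r ∈ Ioc a b, (∀ᶠ r' in 𝓝[<] r, -L * (r - r') ≤ f r - f r') → r ∈ s) :
    ENNReal.ofReal (f b - f a + L * (b - a)) ≤ ENNReal.ofReal (C + L) * volume s := by
  set k : ℝ → ℝ := fun r => f r + L * r with hk
  have hkc : ContinuousOn k (Icc a b) := hf.add (continuousOn_const.mul continuousOn_id)
  -- Rising-sun set: the times at which `k` sets a strict record. At a record the left slopes of `f`
  -- are at least `-L`, and on records `k` is Lipschitz with constant `C + L`.
  set F : Set ℝ := {t | t ∈ Ioc a b ∧ ∀ r ∈ Ico a t, k r < k t} with hF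
  have hFs : F ⊆ s := by
    rintro t ⟨ht, htF⟩
    refine hs t ht ?_
    filter_upwards [Ioo_mem_nhdsLT ht.1] with r hr
    have := htF r ⟨hr.1.le, hr.2⟩
    simp only [hk] at this
    linarith
  have hmono : ∀ t₁ ∈ F, ∀ t₂ ∈ F, t₁ ≤ t₂ → |k t₂ - k t₁| ≤ (C + L) * |t₂ - t₁| := by
    intro t₁ h1 t₂ h2 h12
    have hle : f t₂ - f t₁ ≤ C * (t₂ - t₁) :=
      sub_le_of_left_slope_le h12 (hf.mono (Icc_subset_Icc h1.1.1.le h2.1.2))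
        fun r hr => hC r ⟨h1.1.1.trans hr.1, hr.2.trans h2.1.2⟩
    rcases h12.eq_or_lt with rfl | hlt
    · simp
    have := h2.2 t₁ ⟨h1.1.1.le, hlt⟩
    rw [abs_of_nonneg (by linarith), abs_of_nonneg (by linarith)]
    simp only [hk]
    linarith
  have hlip : LipschitzOnWith (C + L).toNNReal k F := by
    refine LipschitzOnWith.of_dist_le_mul fun t₁ h1 t₂ h2 => ?_
    rw [Real.dist_eq, Real.dist_eq, Real.coe_toNNReal _ hCL]
    rcases le_total t₁ t₂ with h | h
    · rw [abs_sub_comm, abs_sub_comm t₁]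
      exact hmono t₁ h1 t₂ h2 h
    · exact hmono t₂ h2 t₁ h1 h
  -- The first time at which `k` reaches a given level is a record, so the records account for the
  -- whole increase of `k`.
  have himage : Ioc (k a) (k b) ⊆ k '' F := by
    intro l hl
    set S : Set ℝ := Icc a b ∩ k ⁻¹' Ici l with hS
    have hSc : IsCompact S :=
      isCompact_Icc.of_isClosed_subset (hkc.preimage_isClosed_of_isClosed isClosed_Icc isClosed_Ici)
        inter_subset_left
    obtain ⟨t, ht, hleast⟩ := hSc.exists_isLeast ⟨b, right_mem_Icc.2 hab, hl.2⟩
    have hta : a < t := by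
      refine lt_of_le_of_ne ht.1.1 ?_
      rintro rfl
      exact (not_le.2 hl.1) ht.2
    have hlt : ∀ r ∈ Ico a t, k r < l := fun r hr => by
      by_contra! hcon
      exact (not_le.2 hr.2) (hleast ⟨⟨hr.1, hr.2.le.trans ht.1.2⟩, hcon⟩)
    obtain ⟨c, hc, hcl⟩ := intermediate_value_Icc hta.le
      (hkc.mono (Icc_subset_Icc le_rfl ht.1.2)) (show l ∈ Icc (k a) (k t) from ⟨hl.1.le, ht.2⟩)
    have hct : c = t := by
      by_contra hne
      exact absurd hcl (hlt c ⟨hc.1, lt_of_le_of_ne hc.2 hne⟩).ne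
    subst hct
    exact ⟨c, ⟨⟨hta, ht.1.2⟩, fun r hr => hcl ▸ hlt r hr⟩, hcl⟩
  calc ENNReal.ofReal (f b - f a + L * (b - a)) = volume (Ioc (k a) (k b)) := by
        rw [Real.volume_Ioc]; congr 1; simp only [hk]; ring
    _ ≤ volume (k '' F) := measure_mono himage
    _ ≤ ENNReal.ofReal (C + L) * volume F := by
        have := hlip.hausdorffMeasure_image_le (d := 1) zero_le_one
        simpa [hausdorffMeasure_real, ENNReal.ofReal] using this
    _ ≤ _ := by gcongr

end OneSidedSlopes

/-! ### Degenerate flows and their contact points. -/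

section Contact

open Filter Topology Module Metric

/-- A nonnegative function `V` on `ℝᵈ × ℝ` which vanishes on `O` at time `0` and, wherever it is
positive in `O × [0,T]`, satisfies `|V_t - κ V^γ |∇V|^β ΔV| ≤ μ V^γ |∇V|^(β+1)` with (left) time
derivative `S`. -/
structure DegenerateFlow {d : ℕ} (κ μ γ β T : ℝ) (O : Set (EuclideanSpace ℝ (Fin d)))
    (V S : EuclideanSpace ℝ (Fin d) → ℝ → ℝ) : Prop where
  continuous : Continuous fun z : EuclideanSpace ℝ (Fin d) × ℝ => V z.1 z.2
  nonneg : ∀ x t, 0 ≤ V x t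
  initial : ∀ x ∈ O, V x 0 = 0
  contDiffAt : ∀ x ∈ O, ∀ t ∈ Icc 0 T, 0 < V x t → ContDiffAt ℝ 2 (fun y => V y t) x
  hasDerivWithinAt : ∀ x ∈ O, ∀ t ∈ Icc 0 T, 0 < V x t →
    HasDerivWithinAt (V x) (S x t) (Iic t) t
  continuousOn_deriv : ContinuousOn (fun z : EuclideanSpace ℝ (Fin d) × ℝ => S z.1 z.2)
    {z | z.1 ∈ O ∧ z.2 ∈ Icc 0 T ∧ 0 < V z.1 z.2}
  equation : ∀ x ∈ O, ∀ t ∈ Icc 0 T, 0 < V x t →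
    |S x t - κ * V x t ^ γ * ‖gradient (fun y => V y t) x‖ ^ β
        * Laplacian.laplacian (fun y => V y t) x| ≤
      μ * V x t ^ γ * ‖gradient (fun y => V y t) x‖ ^ β * ‖gradient (fun y => V y t) x‖

variable {d : ℕ} {κ μ γ β T : ℝ} {O : Set (EuclideanSpace ℝ (Fin d))}
  {V S : EuclideanSpace ℝ (Fin d) → ℝ → ℝ}

/-- The first conclusion recovers the vertex from the contact point. Touching bounds `|∇V|^β D²V`
above, hence also `V_t` through the equation. Conversely a lower bound on `V_t` bounds the weighted
trace below, and a form bounded above with trace bounded below is bounded. -/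
theorem DegenerateFlow.contact_estimates (hV : DegenerateFlow κ μ γ β T O V S) (hκ : 0 < κ)
    (hμ : 0 ≤ μ) (hβ : 0 ≤ β) {A R t : ℝ} (hA : 0 < A) {y z : EuclideanSpace ℝ (Fin d)}
    (hy : y ∈ O) (ht : t ∈ Icc 0 T) (hpos : 0 < V y t) (hR : ‖y - z‖ ≤ R)
    (htouch : ∀ᶠ y' in 𝓝 y, V y' t - A * ‖y' - z‖ ^ ((β + 2) / (β + 1)) ≤
      V y t - A * ‖y - z‖ ^ ((β + 2) / (β + 1))) :
    ‖gradient (fun y => V y t) y‖ ^ β • gradient (fun y => V y t) y =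
      (A * ((β + 2) / (β + 1))) ^ (β + 1) • (y - z) ∧
    S y t ≤ V y t ^ γ * ((A * ((β + 2) / (β + 1))) ^ (β + 1) * (κ * d + μ * R)) ∧
    ∀ L, 0 ≤ L → -L ≤ S y t →
      ‖gradient (fun y => V y t) y‖ ^ β * ‖fderiv ℝ (fderiv ℝ fun y => V y t) y‖ ≤
        (L / V y t ^ γ + μ * (A * ((β + 2) / (β + 1))) ^ (β + 1) * R) / κ
          + d * (A * ((β + 2) / (β + 1))) ^ (β + 1) := by
  set f : EuclideanSpace ℝ (Fin d) → ℝ := fun y => V y t with hf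
  set D : ℝ := (A * ((β + 2) / (β + 1))) ^ (β + 1) with hD
  have hDpos : 0 < D := by positivity
  have hR0 : 0 ≤ R := (norm_nonneg _).trans hR
  have hfd : ContDiffAt ℝ 2 f y := hV.contDiffAt y hy t ht hpos
  obtain ⟨h1, h2⟩ := norm_gradient_rpow_of_touching_rpow (z := z) hA hβ hfd (by
    filter_upwards [htouch] with y' hy'
    simp only [hf]
    linarith)
  rw [← hD] at h1 h2
  have hVγ : 0 < V y t ^ γ := Real.rpow_pos_of_pos hpos γ
  set w : ℝ := ‖gradient f y‖ ^ β with hw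
  have hw0 : 0 ≤ w := by positivity
  have hwg : w * ‖gradient f y‖ ≤ D * R := by
    have := congrArg norm h1
    rw [norm_smul, norm_smul, Real.norm_of_nonneg hw0, Real.norm_of_nonneg hDpos.le] at this
    rw [this]
    gcongr
  have heq := hV.equation y hy t ht hpos
  rw [← hf, ← hw] at heq
  have hdrift : μ * V y t ^ γ * w * ‖gradient f y‖ ≤ V y t ^ γ * (μ * (D * R)) := by
    calc _ = V y t ^ γ * (μ * (w * ‖gradient f y‖)) := by ring
      _ ≤ _ := by gcongr
  have hlapD : w * Laplacian.laplacian f y ≤ d * D := by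
    rw [laplacian_eq_sum_fderiv_fderiv (stdOrthonormalBasis ℝ _), Finset.mul_sum]
    refine (Finset.sum_le_sum (g := fun _ => D) fun i _ => ?_).trans ?_
    · simpa using h2 (stdOrthonormalBasis ℝ _ i)
    · simp
  refine ⟨h1, ?_, fun L hL hLS => ?_⟩
  · have h3 := (abs_le.1 heq).2
    have h4 : κ * V y t ^ γ * (w * Laplacian.laplacian f y) ≤ κ * V y t ^ γ * (d * D) := by gcongr
    nlinarith
  · have h3 := (abs_le.1 heq).2
    have h4 : -((L / V y t ^ γ + μ * D * R) / κ) ≤ w * Laplacian.laplacian f y := by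
      rw [neg_le_iff_add_nonneg, ← sub_nonneg]
      have h5 : 0 ≤ κ * V y t ^ γ *
          (w * Laplacian.laplacian f y + (L / V y t ^ γ + μ * D * R) / κ) := by
        have h6 : κ * V y t ^ γ *
            (w * Laplacian.laplacian f y + (L / V y t ^ γ + μ * D * R) / κ) =
            κ * V y t ^ γ * w * Laplacian.laplacian f y + L + V y t ^ γ * (μ * (D * R)) := by
          field_simp
          ring
        rw [h6]
        linarith
      simpa using nonneg_of_mul_nonneg_right h5 (by positivity)
    have h7 := mul_opNorm_le_of_le_of_trace_ge (B := fderiv ℝ (fderiv ℝ f) y) (c := D)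
      (m := (L / V y t ^ γ + μ * D * R) / κ) (hfd.isSymmSndFDerivAt (by simp)).eq hw0
      hDpos.le (by positivity) h2 (fun b => by
        rw [← laplacian_eq_sum_fderiv_fderiv b]; exact h4)
    simpa using h7

/-- The largest value on a ball of `V - A |x - z|^α` at time `t`. -/
noncomputable def contactMax (V : EuclideanSpace ℝ (Fin d) → ℝ → ℝ) (A α : ℝ)
    (x₀ : EuclideanSpace ℝ (Fin d)) (ρ : ℝ) (z : EuclideanSpace ℝ (Fin d)) (t : ℝ) : ℝ :=
  sSup ((fun y => V y t - A * ‖y - z‖ ^ α) '' closedBall x₀ ρ)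

variable {A α ρ : ℝ} {x₀ : EuclideanSpace ℝ (Fin d)}

theorem continuous_contactMax
    (hV : Continuous fun z : EuclideanSpace ℝ (Fin d) × ℝ => V z.1 z.2) (hα : 0 ≤ α) :
    Continuous fun w : EuclideanSpace ℝ (Fin d) × ℝ => contactMax V A α x₀ ρ w.1 w.2 := by
  refine (isCompact_closedBall x₀ ρ).continuous_sSup
    (f := fun (w : EuclideanSpace ℝ (Fin d) × ℝ) y => V y w.2 - A * ‖y - w.1‖ ^ α) ?_
  have h1 : Continuous fun p : (EuclideanSpace ℝ (Fin d) × ℝ) × EuclideanSpace ℝ (Fin d) =>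
      V p.2 p.1.2 := hV.comp (by fun_prop : Continuous fun
        p : (EuclideanSpace ℝ (Fin d) × ℝ) × EuclideanSpace ℝ (Fin d) => (p.2, p.1.2))
  have h2 : Continuous fun p : (EuclideanSpace ℝ (Fin d) × ℝ) × EuclideanSpace ℝ (Fin d) =>
      ‖p.2 - p.1.1‖ ^ α := by
    refine Continuous.rpow_const (by fun_prop) fun _ => Or.inr hα
  exact h1.sub (continuous_const.mul h2)

theorem continuous_sub_norm_rpow
    (hV : Continuous fun z : EuclideanSpace ℝ (Fin d) × ℝ => V z.1 z.2) (hα : 0 ≤ α)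
    (z : EuclideanSpace ℝ (Fin d)) (t : ℝ) : Continuous fun y => V y t - A * ‖y - z‖ ^ α := by
  have h1 : Continuous fun y => V y t := hV.comp (by fun_prop : Continuous fun y => (y, t))
  have h2 : Continuous fun y => ‖y - z‖ ^ α :=
    Continuous.rpow_const (by fun_prop) fun _ => Or.inr hα
  exact h1.sub (continuous_const.mul h2)

theorem le_contactMax
    (hV : Continuous fun z : EuclideanSpace ℝ (Fin d) × ℝ => V z.1 z.2) (hα : 0 ≤ α)
    {y : EuclideanSpace ℝ (Fin d)} (hy : y ∈ closedBall x₀ ρ) (z : EuclideanSpace ℝ (Fin d))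
    (t : ℝ) : V y t - A * ‖y - z‖ ^ α ≤ contactMax V A α x₀ ρ z t :=
  le_csSup ((isCompact_closedBall x₀ ρ).bddAbove_image
    (continuous_sub_norm_rpow hV hα z t).continuousOn) (mem_image_of_mem _ hy)

theorem exists_eq_contactMax
    (hV : Continuous fun z : EuclideanSpace ℝ (Fin d) × ℝ => V z.1 z.2) (hα : 0 ≤ α)
    (hρ : 0 ≤ ρ) (z : EuclideanSpace ℝ (Fin d)) (t : ℝ) :
    ∃ y ∈ closedBall x₀ ρ, contactMax V A α x₀ ρ z t = V y t - A * ‖y - z‖ ^ α := by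
  obtain ⟨y, hy, h, -⟩ := (isCompact_closedBall x₀ ρ).exists_sSup_image_eq_and_ge
    (nonempty_closedBall.2 hρ) (continuous_sub_norm_rpow (A := A) hV hα z t).continuousOn
  exact ⟨y, hy, h⟩

end Contact

/-! ### Volume of vertices at a fixed time, and abundance of good times. -/

section Growth

open Filter Topology Module Metric

variable {d : ℕ} {κ μ γ β T : ℝ} {O : Set (EuclideanSpace ℝ (Fin d))}
  {V S : EuclideanSpace ℝ (Fin d) → ℝ → ℝ}

/-- `G` lies in the image, under the vertex map, of a closed set of contact points on which the
derivative of that map is bounded by `1 + (1 + β) C`. -/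
theorem DegenerateFlow.volume_vertices_le (hV : DegenerateFlow κ μ γ β T O V S) (hβ : 0 ≤ β)
    {c C h ρ t : ℝ} (hc : 0 ≤ c) (hh : 0 < h) {x₀ : EuclideanSpace ℝ (Fin d)}
    (hO : closedBall x₀ ρ ⊆ O) (ht : t ∈ Icc 0 T) {G : Set (EuclideanSpace ℝ (Fin d))}
    (hG : ∀ z ∈ G, ∃ y ∈ closedBall x₀ ρ, h ≤ V y t ∧
      c * (‖gradient (fun y => V y t) y‖ ^ β * ‖fderiv ℝ (fderiv ℝ fun y => V y t) y‖) ≤ C ∧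
      y - c • (‖gradient (fun y => V y t) y‖ ^ β • gradient (fun y => V y t) y) = z) :
    volume G ≤ ENNReal.ofReal ((1 + (1 + β) * C) ^ d) *
      volume {y ∈ closedBall x₀ ρ | h ≤ V y t} := by
  set f : EuclideanSpace ℝ (Fin d) → ℝ := fun y => V y t with hf
  have hfc : Continuous f := hV.continuous.comp (by fun_prop : Continuous fun y => (y, t))
  set P : Set (EuclideanSpace ℝ (Fin d)) := {y ∈ closedBall x₀ ρ | h ≤ f y} with hP
  have hPc : IsClosed P := isClosed_closedBall.inter (isClosed_le continuous_const hfc)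
  have hsmooth : ∀ y ∈ P, ContDiffAt ℝ 2 f y := fun y hy =>
    hV.contDiffAt y (hO hy.1) t ht (hh.trans_le hy.2)
  set F : EuclideanSpace ℝ (Fin d) → ℝ := fun y =>
    c * (‖gradient f y‖ ^ β * ‖fderiv ℝ (fderiv ℝ f) y‖) with hF
  have hFc : ContinuousOn F P := fun y hy => by
    obtain ⟨G', hG', -⟩ := exists_hasFDerivAt_gradient (hsmooth y hy)
    have h1 : ContinuousAt (fun y => ‖gradient f y‖ ^ β) y :=
      hG'.continuousAt.norm.rpow_const (Or.inr hβ)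
    have h2 : ContinuousAt (fderiv ℝ (fderiv ℝ f)) y :=
      (((hsmooth y hy).fderiv_right (m := 1) (by norm_num)).fderiv_right
        (m := 0) (by norm_num)).continuousAt
    have h3 := (continuous_norm (E := EuclideanSpace ℝ (Fin d) →L[ℝ]
      EuclideanSpace ℝ (Fin d) →L[ℝ] ℝ)).continuousAt (x := fderiv ℝ (fderiv ℝ f) y)
    exact (continuousAt_const.mul (h1.mul (h3.comp h2))).continuousWithinAt
  have hYc : IsClosed (P ∩ F ⁻¹' Iic C) := hFc.preimage_isClosed_of_isClosed hPc isClosed_Iic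
  have hsub : G ⊆ (fun y => y - c • (‖gradient f y‖ ^ β • gradient f y)) '' (P ∩ F ⁻¹' Iic C) := by
    intro z hz
    obtain ⟨y, hy, hyh, hyC, hyz⟩ := hG z hz
    exact ⟨y, ⟨⟨hy, hyh⟩, hyC⟩, hyz⟩
  have hvol := volume_image_le_of_norm_hasFDerivAt_le hYc.measurableSet
    (Z := fun y => y - c • (‖gradient f y‖ ^ β • gradient f y)) (C := 1 + (1 + β) * C)
    (fun y hy => by
      obtain ⟨Z', hZ, hZn⟩ := exists_hasFDerivAt_vertexMap (hsmooth y hy.1) hc hβ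
      refine ⟨Z', hZ, hZn.trans ?_⟩
      have : F y ≤ C := hy.2
      gcongr)
  rw [finrank_euclideanSpace_fin] at hvol
  calc volume G ≤ _ := measure_mono hsub
    _ ≤ _ := hvol
    _ ≤ _ := by gcongr; exact inter_subset_left

/-- The coefficient makes the sliding function equal to `Q h ≥ V` at distance `ρ / 2` from the
vertex. A positive contact value thus forces `‖y - z‖ < ρ / 2`, and as `z` is within `ρ / 8` of `x₀`
the contact is interior. -/
theorem DegenerateFlow.contact_interior (hV : DegenerateFlow κ μ γ β T O V S) (hβ : 0 ≤ β)
    {h Q ρ R t : ℝ} (hh : 0 < h) (hQ : 1 ≤ Q) (hρ : 0 < ρ) (hρR : ρ ≤ R)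
    {x₀ y z : EuclideanSpace ℝ (Fin d)} (ht : t ∈ Icc 0 T)
    (hle : ∀ x ∈ closedBall x₀ ρ, ∀ t ∈ Icc 0 T, V x t ≤ Q * h)
    (hz : z ∈ closedBall x₀ (ρ / (8 * Q))) (hy : y ∈ closedBall x₀ ρ)
    (hcontact : contactMax V (Q * h * (2 / ρ) ^ ((β + 2) / (β + 1))) ((β + 2) / (β + 1)) x₀ ρ z t =
      V y t - Q * h * (2 / ρ) ^ ((β + 2) / (β + 1)) * ‖y - z‖ ^ ((β + 2) / (β + 1)))
    (hpos : 0 < contactMax V (Q * h * (2 / ρ) ^ ((β + 2) / (β + 1))) ((β + 2) / (β + 1))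
      x₀ ρ z t) :
    contactMax V (Q * h * (2 / ρ) ^ ((β + 2) / (β + 1))) ((β + 2) / (β + 1)) x₀ ρ z t ≤ V y t ∧
    ‖y - z‖ ≤ R ∧
    ∀ᶠ y' in 𝓝 y, V y' t - Q * h * (2 / ρ) ^ ((β + 2) / (β + 1)) *
      ‖y' - z‖ ^ ((β + 2) / (β + 1)) ≤
      V y t - Q * h * (2 / ρ) ^ ((β + 2) / (β + 1)) * ‖y - z‖ ^ ((β + 2) / (β + 1)) := by
  set α : ℝ := (β + 2) / (β + 1) with hα
  have hα0 : 0 < α := by positivity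
  set A : ℝ := Q * h * (2 / ρ) ^ α with hA
  have hQ0 : 0 < Q := by linarith
  have hnn : 0 ≤ A * ‖y - z‖ ^ α := by positivity
  have hlt : ‖y - z‖ < ρ / 2 := by
    by_contra! hcon
    have h1 : (ρ / 2) ^ α ≤ ‖y - z‖ ^ α := Real.rpow_le_rpow (by positivity) hcon hα0.le
    have h2 : Q * h ≤ A * ‖y - z‖ ^ α := by
      calc Q * h = A * (ρ / 2) ^ α := by
            rw [hA, mul_assoc, ← Real.mul_rpow (by positivity) (by positivity)]
            rw [show 2 / ρ * (ρ / 2) = 1 by field_simp, Real.one_rpow, mul_one]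
        _ ≤ _ := by gcongr
    have h3 := hle y hy t ht
    linarith
  have hball : y ∈ ball x₀ ρ := by
    rw [mem_closedBall] at hz
    rw [mem_ball]
    have h1 : ρ / (8 * Q) ≤ ρ / 8 := by gcongr; linarith
    have h2 := dist_triangle y z x₀
    rw [dist_eq_norm y z] at h2
    linarith
  refine ⟨by linarith, by linarith, ?_⟩
  filter_upwards [isOpen_ball.mem_nhds hball] with y' hy'
  have := le_contactMax (A := A) hV.continuous hα0.le (ball_subset_closedBall hy') z t
  linarith

/-- Seen from each vertex `z` near `x₀`, for at least half of the times in
`[t₀ - τ, t₀]` there is a contact point where `V` is not small and does not decrease fast. -/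
theorem DegenerateFlow.half_le_volume_contact_times (hV : DegenerateFlow κ μ γ β T O V S)
    (hd : 1 ≤ d) (hκ : 0 < κ) (hμ : 0 ≤ μ) (hβ : 0 ≤ β)
    {h Q ρ R t₀ C τ : ℝ} (hh : 0 < h) (hQ : 1 ≤ Q) (hρ : 0 < ρ) (hρR : ρ ≤ R)
    (hγ : 0 < γ) {x₀ : EuclideanSpace ℝ (Fin d)} (hO : closedBall x₀ ρ ⊆ O)
    (ht₀ : t₀ ∈ Icc 0 T) (hx₀ : V x₀ t₀ = h)
    (hle : ∀ x ∈ closedBall x₀ ρ, ∀ t ∈ Icc 0 T, V x t ≤ Q * h)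
    (hC : C = (Q * h) ^ γ * ((Q * h * (2 / ρ) ^ ((β + 2) / (β + 1)) *
      ((β + 2) / (β + 1))) ^ (β + 1) * (κ * d + μ * R)))
    (hτ : τ = h / (8 * C)) {z : EuclideanSpace ℝ (Fin d)}
    (hz : z ∈ closedBall x₀ (ρ / (8 * Q))) :
    τ < t₀ ∧ ENNReal.ofReal (τ / 2) ≤ volume {t ∈ Icc (t₀ - τ) t₀ | ∃ y ∈ closedBall x₀ ρ,
      contactMax V (Q * h * (2 / ρ) ^ ((β + 2) / (β + 1))) ((β + 2) / (β + 1)) x₀ ρ z t =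
        V y t - Q * h * (2 / ρ) ^ ((β + 2) / (β + 1)) * ‖y - z‖ ^ ((β + 2) / (β + 1)) ∧
      h / 2 ≤ contactMax V (Q * h * (2 / ρ) ^ ((β + 2) / (β + 1))) ((β + 2) / (β + 1)) x₀ ρ z t ∧
      h / 2 ≤ V y t ∧ -((16 * Q + 1) * C) ≤ S y t} := by
  have hint := fun (y : EuclideanSpace ℝ (Fin d)) (t : ℝ) (ht : t ∈ Icc 0 T) =>
    hV.contact_interior (y := y) hβ hh hQ hρ hρR ht hle hz
  set α : ℝ := (β + 2) / (β + 1) with hα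
  have hα1 : 1 ≤ α := by rw [hα, le_div_iff₀ (by linarith)]; linarith
  have hα0 : 0 ≤ α := by linarith
  have hQ0 : 0 < Q := by linarith
  set A : ℝ := Q * h * (2 / ρ) ^ α with hA
  have hApos : 0 < A := by positivity
  have hR : 0 < R := hρ.trans_le hρR
  have hCpos : 0 < C := by
    have : (1 : ℝ) ≤ d := by exact_mod_cast hd
    rw [hC]; positivity
  have hτpos : 0 < τ := by rw [hτ]; positivity
  have hCτ : C * τ = h / 8 := by rw [hτ]; field_simp
  set f : ℝ → ℝ := contactMax V A α x₀ ρ z with hf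
  have hfc : Continuous f := (continuous_contactMax hV.continuous hα0).comp
    (by fun_prop : Continuous fun t : ℝ => (z, t))
  -- The contact point at time `r` is still a competitor at earlier times, so a lower bound on the
  -- left slopes of `f` passes to those of `V y`.
  have hslope : ∀ r ∈ Icc 0 T, h / 2 < f r → ∀ y ∈ closedBall x₀ ρ,
      f r = V y r - A * ‖y - z‖ ^ α →
      (∀ m : ℝ, (∀ᶠ r' in 𝓝[<] r, m * (r - r') ≤ f r - f r') → m ≤ S y r) ∧ S y r ≤ C ∧
      h / 2 ≤ V y r := by
    intro r hr hfr y hy hcon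
    obtain ⟨h1, h2, h3⟩ := hint y r hr hy hcon (by linarith)
    have hVpos : 0 < V y r := by linarith
    refine ⟨fun m hm => ?_, ?_, by linarith⟩
    · refine le_of_hasDerivWithinAt_Iic (hV.hasDerivWithinAt y (hO hy) r hr hVpos) ?_
      filter_upwards [hm] with r' hr'
      have := le_contactMax (A := A) hV.continuous hα0 hy z r'
      simp only [← hf] at this
      linarith
    · refine (hV.contact_estimates hκ hμ hβ hApos (hO hy) hr hVpos h2 h3).2.1.trans ?_
      rw [hC, ← hα]
      have := hle y hy r hr
      gcongr
  -- Take `x₀` as competitor: the radius `ρ / (8Q)` makes the subtracted term `Q h (1/(4Q))^α ≤ h /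
  -- 4`.
  have hf₀ : 3 * h / 4 ≤ f t₀ := by
    have h1 := le_contactMax (A := A) hV.continuous hα0 (mem_closedBall_self hρ.le) z t₀
      (x₀ := x₀) (ρ := ρ)
    rw [hx₀] at h1
    have h2 : ‖x₀ - z‖ ≤ ρ / (8 * Q) := by rw [← dist_eq_norm, dist_comm]; exact hz
    have h3 : A * ‖x₀ - z‖ ^ α ≤ h / 4 := by
      calc A * ‖x₀ - z‖ ^ α ≤ A * (ρ / (8 * Q)) ^ α := by gcongr
        _ = Q * h * (1 / (4 * Q)) ^ α := by
          rw [hA, mul_assoc, ← Real.mul_rpow (by positivity) (by positivity)]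
          congr 2; field_simp; norm_num
        _ ≤ Q * h * (1 / (4 * Q)) ^ (1 : ℝ) := by
          gcongr _ * ?_
          refine Real.rpow_le_rpow_of_exponent_ge (by positivity) ?_ hα1
          rw [div_le_one (by positivity)]; linarith
        _ = h / 4 := by rw [Real.rpow_one]; field_simp
    linarith
  -- After the last time with `f ≤ h / 2` the slopes are at most `C`, so within time `τ` the
  -- function `f` gains at most `C τ = h / 8`, too little to reach `3h / 4`.
  have hhalf : ∀ t ∈ Icc 0 t₀, t₀ - τ ≤ t → h / 2 < f t := by
    intro t ht htτ
    by_contra! hcon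
    have hKc : IsCompact (Icc t t₀ ∩ f ⁻¹' Iic (h / 2)) :=
      isCompact_Icc.inter_right (isClosed_Iic.preimage hfc)
    obtain ⟨t₁, ht₁, hgreat⟩ := hKc.exists_isGreatest ⟨t, left_mem_Icc.2 ht.2, hcon⟩
    have h1 := sub_le_of_left_slope_le (C := C) ht₁.1.2 hfc.continuousOn (by
      intro r hr m hm
      have hfr : h / 2 < f r := by
        by_contra! hle'
        exact (not_le.2 hr.1) (hgreat ⟨⟨ht₁.1.1.trans hr.1.le, hr.2⟩, hle'⟩)
      obtain ⟨y, hy, hcon'⟩ := exists_eq_contactMax (A := A) (x₀ := x₀) hV.continuous hα0 hρ.le z r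
      have hrT : r ∈ Icc 0 T := ⟨ht.1.trans (ht₁.1.1.trans hr.1.le), hr.2.trans ht₀.2⟩
      obtain ⟨h2, h3, -⟩ := hslope r hrT hfr y hy hcon'
      exact (h2 m hm).trans h3)
    have h2 : f t₁ ≤ h / 2 := ht₁.2
    have h3 : C * (t₀ - t₁) ≤ C * τ := by gcongr; linarith [ht₁.1.1]
    linarith
  have hτt₀ : τ < t₀ := by
    by_contra! hcon
    have h1 := hhalf 0 ⟨le_rfl, ht₀.1⟩ (by linarith)
    obtain ⟨y, hy, hcon'⟩ := exists_eq_contactMax (A := A) (x₀ := x₀) hV.continuous hα0 hρ.le z 0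
    rw [← hf, hV.initial y (hO hy)] at hcon'
    have : 0 ≤ A * ‖y - z‖ ^ α := by positivity
    linarith
  refine ⟨hτt₀, ?_⟩
  have hmemT : ∀ r ∈ Ioc (t₀ - τ) t₀, r ∈ Icc 0 T ∧ h / 2 < f r := fun r hr =>
    ⟨⟨by linarith [hr.1], hr.2.trans ht₀.2⟩, hhalf r ⟨by linarith [hr.1], hr.2⟩ hr.1.le⟩
  have hmain := ofReal_sub_add_le_mul_volume (C := C) (L := (16 * Q + 1) * C)
    (a := t₀ - τ) (b := t₀) (f := f)
    (s := {t ∈ Icc (t₀ - τ) t₀ | ∃ y ∈ closedBall x₀ ρ, f t = V y t - A * ‖y - z‖ ^ α ∧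
      h / 2 ≤ f t ∧ h / 2 ≤ V y t ∧ -((16 * Q + 1) * C) ≤ S y t}) (by linarith) (by positivity)
    hfc.continuousOn
    (fun r hr m hm => by
      obtain ⟨y, hy, hcon⟩ := exists_eq_contactMax (A := A) (x₀ := x₀) hV.continuous hα0 hρ.le z r
      obtain ⟨h2, h3, -⟩ := hslope r (hmemT r hr).1 (hmemT r hr).2 y hy hcon
      exact (h2 m hm).trans h3)
    (fun r hr hm => by
      obtain ⟨y, hy, hcon⟩ := exists_eq_contactMax (A := A) (x₀ := x₀) hV.continuous hα0 hρ.le z r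
      obtain ⟨h2, -, h3⟩ := hslope r (hmemT r hr).1 (hmemT r hr).2 y hy hcon
      exact ⟨Ioc_subset_Icc_self hr, y, hy, hcon, (hmemT r hr).2.le, h3, h2 _ hm⟩)
  have hfa : f (t₀ - τ) ≤ Q * h := by
    obtain ⟨y, hy, hcon⟩ :=
      exists_eq_contactMax (A := A) (x₀ := x₀) hV.continuous hα0 hρ.le z (t₀ - τ)
    have h1 := hle y hy (t₀ - τ) ⟨by linarith, by linarith [ht₀.2]⟩
    have : 0 ≤ A * ‖y - z‖ ^ α := by positivity
    simp only [← hf] at hcon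
    linarith
  have hposC : 0 < C + (16 * Q + 1) * C := by positivity
  -- Here `f` loses at most `Q h` over the interval, while the choice `L = (16 Q + 1) C` gives `L τ
  -- = 2 Q h + h / 8`. This is what leaves half of the times.
  have hlow : (C + (16 * Q + 1) * C) * (τ / 2) ≤
      f t₀ - f (t₀ - τ) + (16 * Q + 1) * C * (t₀ - (t₀ - τ)) := by
    have h1 : (C + (16 * Q + 1) * C) * (τ / 2) = (16 * Q + 2) / 2 * (C * τ) := by ring
    have h2 : (16 * Q + 1) * C * (t₀ - (t₀ - τ)) = (16 * Q + 1) * (C * τ) := by ring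
    rw [h1, h2, hCτ]
    linarith
  have hfinal := (ENNReal.ofReal_le_ofReal hlow).trans hmain
  rw [ENNReal.ofReal_mul hposC.le] at hfinal
  exact (ENNReal.mul_le_mul_iff_right (by simpa using hposC) ENNReal.ofReal_ne_top).1 hfinal

end Growth

/-! ### The measure estimate in space-time. -/

section GrowthLemma

open Filter Topology Module Metric

variable {d : ℕ} {κ μ γ β T : ℝ} {O : Set (EuclideanSpace ℝ (Fin d))}
  {V S : EuclideanSpace ℝ (Fin d) → ℝ → ℝ}

/-- The Lipschitz constant of the map from contact points to vertices. -/
noncomputable def growthConst (d : ℕ) (κ μ γ β R Q : ℝ) : ℝ :=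
  1 + (1 + β) * (((16 * Q + 1) * (2 * Q) ^ γ * (κ * d + μ * R) + μ * R) / κ + d)

theorem one_le_growthConst (d : ℕ) {κ μ γ β R Q : ℝ} (hκ : 0 < κ) (hμ : 0 ≤ μ) (hβ : 0 ≤ β)
    (hR : 0 ≤ R) (hQ : 0 ≤ Q) : 1 ≤ growthConst d κ μ γ β R Q := by
  rw [growthConst, le_add_iff_nonneg_right]
  positivity

/-- The set is a projection of a compact set of triples (vertex, contact point, time). Compactness
supplies the measurability needed for Fubini's theorem. -/
theorem DegenerateFlow.isCompact_contactSet (hV : DegenerateFlow κ μ γ β T O V S)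
    {A α h L ρ η a b : ℝ} (hα : 0 ≤ α) (hh : 0 < h) (ha : 0 ≤ a) (hb : b ≤ T)
    {x₀ : EuclideanSpace ℝ (Fin d)} (hO : closedBall x₀ ρ ⊆ O) :
    IsCompact {w : EuclideanSpace ℝ (Fin d) × ℝ | w.1 ∈ closedBall x₀ η ∧ w.2 ∈ Icc a b ∧
      ∃ y ∈ closedBall x₀ ρ, contactMax V A α x₀ ρ w.1 w.2 = V y w.2 - A * ‖y - w.1‖ ^ α ∧
        h ≤ contactMax V A α x₀ ρ w.1 w.2 ∧ h ≤ V y w.2 ∧ -L ≤ S y w.2} := by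
  set P : Set (EuclideanSpace ℝ (Fin d) × ℝ) :=
    (closedBall x₀ ρ ×ˢ Icc a b) ∩ {w | h ≤ V w.1 w.2} with hP
  have hPc : IsCompact P := ((isCompact_closedBall x₀ ρ).prod isCompact_Icc).inter_right
    (isClosed_le continuous_const hV.continuous)
  have hP' : IsCompact (P ∩ (fun w : EuclideanSpace ℝ (Fin d) × ℝ => S w.1 w.2) ⁻¹' Ici (-L)) := by
    refine hPc.of_isClosed_subset ?_ inter_subset_left
    refine (hV.continuousOn_deriv.mono ?_).preimage_isClosed_of_isClosed hPc.isClosed isClosed_Ici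
    rintro w ⟨hw, hw'⟩
    exact ⟨hO hw.1, ⟨ha.trans hw.2.1, hw.2.2.trans hb⟩, hh.trans_le hw'⟩
  have hm : Continuous fun p : EuclideanSpace ℝ (Fin d) × (EuclideanSpace ℝ (Fin d) × ℝ) =>
      contactMax V A α x₀ ρ p.1 p.2.2 :=
    (continuous_contactMax hV.continuous hα).comp (by fun_prop : Continuous fun
      p : EuclideanSpace ℝ (Fin d) × (EuclideanSpace ℝ (Fin d) × ℝ) => (p.1, p.2.2))
  have hval : Continuous fun p : EuclideanSpace ℝ (Fin d) × (EuclideanSpace ℝ (Fin d) × ℝ) =>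
      V p.2.1 p.2.2 - A * ‖p.2.1 - p.1‖ ^ α := by
    refine (hV.continuous.comp continuous_snd).sub (continuous_const.mul ?_)
    exact Continuous.rpow_const (by fun_prop) fun _ => Or.inr hα
  have hK := (((isCompact_closedBall x₀ η).prod hP').inter_right (isClosed_eq hm hval)).inter_right
    (isClosed_le (continuous_const (y := h)) hm)
  convert hK.image (by fun_prop : Continuous fun
    p : EuclideanSpace ℝ (Fin d) × (EuclideanSpace ℝ (Fin d) × ℝ) => (p.1, p.2.2)) using 1
  ext ⟨z, t⟩
  constructor
  · rintro ⟨hz, ht, y, hy, h1, h2, h3, h4⟩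
    exact ⟨(z, (y, t)), ⟨⟨⟨hz, ⟨⟨hy, ht⟩, h3⟩, h4⟩, h1⟩, h2⟩, rfl⟩
  · rintro ⟨⟨z', y, t'⟩, ⟨⟨⟨hz, ⟨⟨hy, ht⟩, h3⟩, h4⟩, h1⟩, h2⟩, heq⟩
    simp only [Prod.mk.injEq] at heq
    obtain ⟨rfl, rfl⟩ := heq
    exact ⟨hz, ht, y, hy, h1, h2, h3, h4⟩

/-- If `V` reaches the value `h` at the centre of a ball in which it is bounded by `Q h`, then at
some time it is at least `h / 2` on a fixed fraction of the ball. -/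
theorem DegenerateFlow.volume_closedBall_le (hV : DegenerateFlow κ μ γ β T O V S)
    (hd : 1 ≤ d) (hκ : 0 < κ) (hμ : 0 ≤ μ) (hβ : 0 ≤ β) (hγ : 0 < γ)
    {h Q ρ R t₀ : ℝ} (hh : 0 < h) (hQ : 1 ≤ Q) (hρ : 0 < ρ) (hρR : ρ ≤ R)
    {x₀ : EuclideanSpace ℝ (Fin d)} (hO : closedBall x₀ ρ ⊆ O)
    (ht₀ : t₀ ∈ Icc 0 T) (hx₀ : V x₀ t₀ = h)
    (hle : ∀ x ∈ closedBall x₀ ρ, ∀ t ∈ Icc 0 T, V x t ≤ Q * h) {m : ℝ≥0∞}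
    (hm : ∀ t ∈ Ioo 0 T, volume {x ∈ closedBall x₀ ρ | h / 2 ≤ V x t} ≤ m) :
    volume (closedBall x₀ (ρ / (8 * Q))) ≤
      2 * (ENNReal.ofReal (growthConst d κ μ γ β R Q ^ d) * m) := by
  obtain ⟨C, hC⟩ : ∃ C, C = (Q * h) ^ γ * ((Q * h * (2 / ρ) ^ ((β + 2) / (β + 1)) *
      ((β + 2) / (β + 1))) ^ (β + 1) * (κ * d + μ * R)) := ⟨_, rfl⟩
  obtain ⟨τ, hτ⟩ : ∃ τ, τ = h / (8 * C) := ⟨_, rfl⟩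
  have htimes := fun z (hz : z ∈ closedBall x₀ (ρ / (8 * Q))) =>
    hV.half_le_volume_contact_times hd hκ hμ hβ hh hQ hρ hρR hγ hO ht₀ hx₀ hle hC hτ hz
  have hQ0 : 0 < Q := by linarith
  have hR : 0 < R := hρ.trans_le hρR
  have hτt₀ := (htimes x₀ (mem_closedBall_self (by positivity))).1
  have hint := fun (y z : EuclideanSpace ℝ (Fin d)) (t : ℝ) (ht : t ∈ Icc 0 T) =>
    hV.contact_interior (y := y) (z := z) hβ hh hQ hρ hρR ht hle
  set α : ℝ := (β + 2) / (β + 1) with hα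
  have hα0 : 0 < α := by positivity
  set A : ℝ := Q * h * (2 / ρ) ^ α with hA
  have hApos : 0 < A := by positivity
  set D : ℝ := (A * α) ^ (β + 1) with hD
  have hDpos : 0 < D := by positivity
  have hd' : (1 : ℝ) ≤ d := by exact_mod_cast hd
  have hCpos : 0 < C := by rw [hC]; positivity
  have hτpos : 0 < τ := by rw [hτ]; positivity
  set L : ℝ := (16 * Q + 1) * C with hL
  have hLpos : 0 < L := by positivity
  set W : Set (EuclideanSpace ℝ (Fin d) × ℝ) := {w | w.1 ∈ closedBall x₀ (ρ / (8 * Q)) ∧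
    w.2 ∈ Icc (t₀ - τ) t₀ ∧ ∃ y ∈ closedBall x₀ ρ,
      contactMax V A α x₀ ρ w.1 w.2 = V y w.2 - A * ‖y - w.1‖ ^ α ∧
        h / 2 ≤ contactMax V A α x₀ ρ w.1 w.2 ∧ h / 2 ≤ V y w.2 ∧ -L ≤ S y w.2} with hW
  have hWm : MeasurableSet W := (hV.isCompact_contactSet hα0.le (by positivity) (by linarith)
    ht₀.2 hO).isClosed.measurableSet
  have hslice : ∀ t ∈ Icc (t₀ - τ) t₀, volume ((fun z => (z, t)) ⁻¹' W) ≤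
      ENNReal.ofReal (growthConst d κ μ γ β R Q ^ d) *
        volume {y ∈ closedBall x₀ ρ | h / 2 ≤ V y t} := by
    intro t ht
    have htT : t ∈ Icc 0 T := ⟨by linarith [ht.1], ht.2.trans ht₀.2⟩
    refine hV.volume_vertices_le hβ (c := D⁻¹) (by positivity) (by positivity) hO htT ?_
    rintro z ⟨hz, -, y, hy, h1, h2, h3, h4⟩
    obtain ⟨-, hyR, htouch⟩ := hint y z t htT hz hy h1 (by simp only at h2; linarith)
    have hVpos : 0 < V y t := by simp only at h3; linarith
    obtain ⟨e1, -, e2⟩ := hV.contact_estimates hκ hμ hβ hApos (hO hy) htT hVpos hyR htouch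
    rw [← hα, ← hD] at e1 e2
    refine ⟨y, hy, h3, ?_, ?_⟩
    · have e3 := e2 L hLpos.le h4
      rw [inv_mul_le_iff₀ hDpos]
      refine e3.trans ?_
      -- Since `h / 2 ≤ V ≤ Q h` at the contact point, the powers of `h` cancel. The factor `D`
      -- cancels as well, so the bound on the vertex map depends on neither `h` nor `ρ`.
      have hVh : (Q * h) ^ γ / V y t ^ γ ≤ (2 * Q) ^ γ := by
        rw [← Real.div_rpow (by positivity) hVpos.le]
        refine Real.rpow_le_rpow (by positivity) ?_ hγ.le
        rw [div_le_iff₀ hVpos]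
        simp only at h3
        nlinarith
      have hLV : L / V y t ^ γ ≤ (16 * Q + 1) * (2 * Q) ^ γ * (κ * d + μ * R) * D := by
        calc L / V y t ^ γ = (16 * Q + 1) * ((Q * h) ^ γ / V y t ^ γ) * (κ * d + μ * R) * D := by
              rw [hL, hC]; ring
          _ ≤ _ := by gcongr
      calc (L / V y t ^ γ + μ * D * R) / κ + d * D
          ≤ ((16 * Q + 1) * (2 * Q) ^ γ * (κ * d + μ * R) * D + μ * D * R) / κ + d * D := by gcongr
        _ = _ := by ring
    · rw [e1, smul_smul, inv_mul_cancel₀ hDpos.ne', one_smul, sub_sub_cancel]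
  set K : ℝ≥0∞ := ENNReal.ofReal (growthConst d κ μ γ β R Q ^ d) * m with hK
  have hupper : (volume.prod volume) W ≤ K * ENNReal.ofReal τ := by
    rw [Measure.prod_apply_symm hWm]
    have hae : ∀ᵐ t : ℝ, volume ((fun z => (z, t)) ⁻¹' W) ≤
        (Ico (t₀ - τ) t₀).indicator (fun _ => K) t := by
      -- The time `t₀` may equal `T`, where `hm` gives nothing; it is dropped as a null set.
      filter_upwards [Measure.ae_ne volume t₀] with t hne
      by_cases ht : t ∈ Ico (t₀ - τ) t₀
      · rw [indicator_of_mem ht]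
        refine (hslice t ⟨ht.1, ht.2.le⟩).trans ?_
        rw [hK]
        gcongr
        exact hm t ⟨by linarith [ht.1], ht.2.trans_le ht₀.2⟩
      · rw [indicator_of_notMem ht, nonpos_iff_eq_zero]
        have : (fun z => (z, t)) ⁻¹' W = ∅ := by
          refine eq_empty_of_forall_notMem fun z hz => ht ⟨hz.2.1.1, lt_of_le_of_ne hz.2.1.2 hne⟩
        rw [this, measure_empty]
    refine (lintegral_mono_ae hae).trans ?_
    rw [lintegral_indicator measurableSet_Ico, setLIntegral_const, Real.volume_Ico]
    simp
  -- Integrate in the other order: each vertex has good times of total length at least `τ / 2`.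
  have hlower : ENNReal.ofReal (τ / 2) * volume (closedBall x₀ (ρ / (8 * Q))) ≤
      (volume.prod volume) W := by
    rw [Measure.prod_apply hWm, ← setLIntegral_const]
    refine (setLIntegral_mono' isClosed_closedBall.measurableSet fun z hz => ?_).trans
      (setLIntegral_le_lintegral _ _)
    refine (htimes z hz).2.trans (measure_mono ?_)
    rintro t ⟨ht, hy⟩
    exact ⟨hz, ht, hy⟩
  have hτ2 : ENNReal.ofReal τ = ENNReal.ofReal (τ / 2) * 2 := by
    rw [← ENNReal.ofReal_ofNat, ← ENNReal.ofReal_mul (by positivity)]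
    congr 1; ring
  have hfin := hlower.trans hupper
  rw [hτ2, mul_comm K, mul_assoc] at hfin
  exact (ENNReal.mul_le_mul_iff_right (by simpa using hτpos) ENNReal.ofReal_ne_top).1 hfin

end GrowthLemma

/-! ### Comparison with a barrier: extinction of small flows. -/

section Barrier

open Filter Topology Module Metric
open scoped RealInnerProductSpace

theorem one_add_pow_le_quadratic (m : ℕ) {s : ℝ} (hs : |s| ≤ 1) :
    (1 + s) ^ m ≤ 1 + m * s + 3 ^ m * s ^ 2 := by
  obtain ⟨h1, h2⟩ := abs_le.1 hs
  induction m with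
  | zero => simp; positivity
  | succ m ih =>
    have hm : (m : ℝ) ≤ 3 ^ m := by
      have : m < 3 ^ m := Nat.lt_pow_self (by norm_num)
      exact_mod_cast this.le
    have h3 : s ^ 3 ≤ s ^ 2 := by nlinarith [sq_nonneg s]
    have h4 : (3 : ℝ) ^ m * s ^ 3 ≤ 3 ^ m * s ^ 2 := by gcongr
    have h5 : m * s ^ 2 ≤ 3 ^ m * s ^ 2 := by gcongr
    calc (1 + s) ^ (m + 1) = (1 + s) * (1 + s) ^ m := by ring
      _ ≤ (1 + s) * (1 + m * s + 3 ^ m * s ^ 2) := by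
        gcongr; linarith
      _ ≤ _ := by push_cast; rw [pow_succ (3 : ℝ) m]; nlinarith

variable {d : ℕ} {κ μ γ β T : ℝ} {O : Set (EuclideanSpace ℝ (Fin d))}
  {V S : EuclideanSpace ℝ (Fin d) → ℝ → ℝ}

theorem eventually_norm_sq_add_pow_le (m : ℕ) {ε : ℝ} (hε : 0 < ε)
    (x₁ y : EuclideanSpace ℝ (Fin d)) :
    ∀ᶠ y' in 𝓝 y, (‖y' - x₁‖ ^ 2 + ε) ^ (m + 1) ≤ (‖y - x₁‖ ^ 2 + ε) ^ (m + 1) +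
      ⟪(2 * (m + 1) * (‖y - x₁‖ ^ 2 + ε) ^ m) • (y - x₁), y' - y⟫ +
      2 * (m + 1 + 9 * 3 ^ (m + 1)) * (‖y - x₁‖ ^ 2 + ε) ^ m * ‖y' - y‖ ^ 2 / 2 := by
  set x := y - x₁ with hx
  set Y : ℝ := ‖x‖ ^ 2 + ε with hY
  have hYpos : 0 < Y := by positivity
  have hr : 0 < √Y := Real.sqrt_pos.2 hYpos
  have hrY : √Y ^ 2 = Y := Real.sq_sqrt hYpos.le
  have hxr : ‖x‖ ≤ √Y := by
    refine Real.le_sqrt_of_sq_le ?_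
    rw [hY]; linarith
  -- The radius `√Y / 3` ensures `|δ| ≤ 3 √Y ‖ξ‖ ≤ Y`, the range of `one_add_pow_le_quadratic`.
  filter_upwards [ball_mem_nhds y (show 0 < √Y / 3 by positivity)] with y' hy'
  rw [mem_ball, dist_eq_norm] at hy'
  set ξ := y' - y with hξ
  have hn0 := norm_nonneg ξ
  set δ : ℝ := 2 * ⟪x, ξ⟫ + ‖ξ‖ ^ 2 with hδ
  have hδ' : |δ| ≤ 3 * √Y * ‖ξ‖ := by
    have h1 : |⟪x, ξ⟫| ≤ √Y * ‖ξ‖ := (abs_real_inner_le_norm x ξ).trans (by gcongr)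
    have h2 : ‖ξ‖ ^ 2 ≤ √Y * ‖ξ‖ := by nlinarith
    obtain ⟨h3, h4⟩ := abs_le.1 h1
    rw [abs_le]
    constructor
    · nlinarith
    · nlinarith
  have hδY : |δ / Y| ≤ 1 := by
    rw [abs_div, abs_of_pos hYpos, div_le_one hYpos]
    refine hδ'.trans ?_
    nlinarith
  have hsq : δ ^ 2 ≤ 9 * Y * ‖ξ‖ ^ 2 := by
    calc δ ^ 2 = |δ| ^ 2 := (sq_abs δ).symm
      _ ≤ (3 * √Y * ‖ξ‖) ^ 2 := by gcongr
      _ = _ := by rw [mul_pow, mul_pow, hrY]; ring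
  have hb := one_add_pow_le_quadratic (m + 1) hδY
  have hy'Y : ‖y' - x₁‖ ^ 2 + ε = Y * (1 + δ / Y) := by
    rw [show y' - x₁ = x + ξ by rw [hx, hξ]; abel, norm_add_sq_real]
    rw [mul_add, mul_one, mul_div_cancel₀ _ hYpos.ne', hY, hδ]; ring
  rw [hy'Y, mul_pow, real_inner_smul_left]
  calc Y ^ (m + 1) * (1 + δ / Y) ^ (m + 1)
      ≤ Y ^ (m + 1) * (1 + ((m + 1 : ℕ) : ℝ) * (δ / Y) + 3 ^ (m + 1) * (δ / Y) ^ 2) := by gcongr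
    _ = Y ^ (m + 1) + (m + 1) * Y ^ m * δ + 3 ^ (m + 1) * (Y ^ m / Y) * δ ^ 2 := by
      push_cast; field_simp; ring
    _ ≤ Y ^ (m + 1) + (m + 1) * Y ^ m * δ + 3 ^ (m + 1) * (Y ^ m / Y) * (9 * Y * ‖ξ‖ ^ 2) := by
      gcongr
    _ = Y ^ (m + 1) + (m + 1) * Y ^ m * δ + 3 ^ (m + 1) * Y ^ m * 9 * ‖ξ‖ ^ 2 := by
      field_simp
    _ = _ := by rw [hδ]; ring

/-- With `r = √(|y - x₁|² + ε)`, the barrier has size `G r^(2m+2)`, gradient at most of order `G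
r^(2m+1)` and Hessian bounded above to order `G r^(2m)`. Collecting powers leaves the barrier
profile times `r` to the exponent `2(m+1)(γ+β) - (β+2)`; condition `hm` makes that exponent
nonnegative, so `r ≤ ρ + 1` bounds the factor. -/
theorem DegenerateFlow.deriv_le_of_touching_barrier (hV : DegenerateFlow κ μ γ β T O V S)
    (hκ : 0 < κ) (hμ : 0 ≤ μ) (hβ : 0 ≤ β) (m : ℕ)
    (hm : β + 2 ≤ 2 * (m + 1) * (γ + β)) {ε ρ G t : ℝ} (hε : 0 < ε) (hε1 : ε ≤ 1)
    (hρ : 0 ≤ ρ) (hG : 0 < G) {x₁ y : EuclideanSpace ℝ (Fin d)} (hy : y ∈ O)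
    (hyρ : ‖y - x₁‖ ≤ ρ) (ht : t ∈ Icc 0 T)
    (heq : V y t = G * (‖y - x₁‖ ^ 2 + ε) ^ (m + 1))
    (htouch : ∀ᶠ y' in 𝓝 y, V y' t ≤ G * (‖y' - x₁‖ ^ 2 + ε) ^ (m + 1)) :
    S y t ≤ (ρ + 1) ^ (2 * (m + 1) * (γ + β) - (β + 2)) * (2 * (m + 1)) ^ β *
      (κ * (d * (2 * (m + 1 + 9 * 3 ^ (m + 1)))) + μ * (2 * (m + 1) * (ρ + 1))) *
      G ^ (1 + (γ + β)) * (‖y - x₁‖ ^ 2 + ε) ^ (m + 1) := by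
  set Y : ℝ := ‖y - x₁‖ ^ 2 + ε with hY
  have hYpos : 0 < Y := by positivity
  set r : ℝ := √Y with hr
  have hrpos : 0 < r := Real.sqrt_pos.2 hYpos
  have hrY : r ^ 2 = Y := Real.sq_sqrt hYpos.le
  have hxr : ‖y - x₁‖ ≤ r := by
    refine Real.le_sqrt_of_sq_le ?_
    rw [hY]; linarith
  have hrρ : r ≤ ρ + 1 := by
    refine Real.sqrt_le_iff.2 ⟨by linarith, ?_⟩
    have : ‖y - x₁‖ ^ 2 ≤ ρ ^ 2 := by gcongr
    rw [hY]; nlinarith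
  have hpos : 0 < V y t := by rw [heq]; positivity
  set f : EuclideanSpace ℝ (Fin d) → ℝ := fun y => V y t with hf
  set M : ℝ := m + 1 + 9 * 3 ^ (m + 1) with hM
  have hMpos : 0 < M := by positivity
  have hfd : ContDiffAt ℝ 2 f y := hV.contDiffAt y hy t ht hpos
  obtain ⟨hg, hH⟩ := gradient_eq_and_hessian_le_of_touching hfd
    (x := (G * (2 * (m + 1) * Y ^ m)) • (y - x₁)) (c := G * (2 * M * Y ^ m)) (by
      filter_upwards [htouch, eventually_norm_sq_add_pow_le m hε x₁ y] with y' h1 h2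
      simp only [hf]
      rw [heq, mul_smul, real_inner_smul_left]
      refine h1.trans ((mul_le_mul_of_nonneg_left h2 hG.le).trans (le_of_eq ?_))
      ring)
  set n : ℝ := ‖gradient f y‖ with hn
  have hYm : Y ^ m = r ^ (2 * m) := by rw [← hrY, pow_mul]
  have hn1 : n ≤ G * (2 * (m + 1)) * r ^ (2 * m + 1) := by
    rw [hn, hg, norm_smul, Real.norm_of_nonneg (by positivity)]
    calc G * (2 * (m + 1) * Y ^ m) * ‖y - x₁‖ ≤ G * (2 * (m + 1) * Y ^ m) * r := by gcongr
      _ = _ := by rw [hYm]; ring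
  have hn0 : 0 ≤ n := norm_nonneg _
  have hlap : Laplacian.laplacian f y ≤ d * (G * (2 * M * r ^ (2 * m))) := by
    rw [laplacian_eq_sum_fderiv_fderiv (stdOrthonormalBasis ℝ _)]
    refine (Finset.sum_le_sum (g := fun _ => G * (2 * M * Y ^ m)) fun i _ => ?_).trans ?_
    · simpa using hH (stdOrthonormalBasis ℝ _ i)
    · simp [hYm]
  have heqn := (abs_le.1 (hV.equation y hy t ht hpos)).2
  rw [← hf, ← hn] at heqn
  have hVγ : 0 ≤ V y t ^ γ := Real.rpow_nonneg hpos.le γ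
  have hnβ : n ^ β ≤ (G * (2 * (m + 1)) * r ^ (2 * m + 1)) ^ β :=
    Real.rpow_le_rpow hn0 hn1 hβ
  have hnβ0 : 0 ≤ n ^ β := Real.rpow_nonneg hn0 β
  have hbr : κ * Laplacian.laplacian f y + μ * n ≤
      G * r ^ (2 * m) * (κ * (d * (2 * M)) + μ * (2 * (m + 1) * (ρ + 1))) := by
    calc κ * Laplacian.laplacian f y + μ * n
        ≤ κ * (d * (G * (2 * M * r ^ (2 * m)))) +
          μ * (G * (2 * (m + 1)) * r ^ (2 * m + 1)) := by gcongr
      _ = G * r ^ (2 * m) * (κ * (d * (2 * M)) + μ * (2 * (m + 1) * r)) := by ring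
      _ ≤ _ := by gcongr
  set B : ℝ := κ * (d * (2 * M)) + μ * (2 * (m + 1) * (ρ + 1)) with hB
  have hB0 : 0 ≤ B := by positivity
  have hpowers : (G * Y ^ (m + 1)) ^ γ * ((G * (2 * (m + 1)) * r ^ (2 * m + 1)) ^ β *
      (G * r ^ (2 * m) * B)) =
      r ^ (2 * (m + 1) * (γ + β) - (β + 2)) * (2 * (m + 1)) ^ β * B * G ^ (1 + (γ + β)) *
        Y ^ (m + 1) := by
    have e1 : Y ^ (m + 1) = r ^ (2 * (m + 1) : ℝ) := by
      rw [← hrY, ← pow_mul, ← Real.rpow_natCast]; congr 1; push_cast; ring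
    have e2 : r ^ (2 * m + 1) = r ^ (2 * m + 1 : ℝ) := by
      rw [← Real.rpow_natCast]; congr 1; push_cast; ring
    have e3 : r ^ (2 * m) = r ^ (2 * m : ℝ) := by
      rw [← Real.rpow_natCast]; congr 1; push_cast; ring
    rw [e1, e2, e3, Real.mul_rpow hG.le (by positivity), Real.mul_rpow (by positivity)
      (by positivity), Real.mul_rpow hG.le (by positivity), ← Real.rpow_mul hrpos.le,
      ← Real.rpow_mul hrpos.le, Real.rpow_add hG, Real.rpow_add hG, Real.rpow_one]
    have e4 : r ^ (2 * (m + 1) * (γ + β) - (β + 2)) * r ^ (2 * (m + 1) : ℝ) =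
        r ^ (2 * (m + 1) * γ) * r ^ ((2 * m + 1) * β) * r ^ (2 * m : ℝ) := by
      rw [← Real.rpow_add hrpos, ← Real.rpow_add hrpos, ← Real.rpow_add hrpos]
      congr 1; ring
    linear_combination -(G ^ γ * G ^ β * (2 * (m + 1)) ^ β * G * B) * e4
  calc S y t ≤ V y t ^ γ * (n ^ β * (κ * Laplacian.laplacian f y + μ * n)) := by linarith
    _ ≤ V y t ^ γ * (n ^ β * (G * r ^ (2 * m) * B)) := by gcongr
    _ ≤ V y t ^ γ * ((G * (2 * (m + 1)) * r ^ (2 * m + 1)) ^ β * (G * r ^ (2 * m) * B)) := by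
      gcongr
    _ = _ := by rw [heq, hpowers]
    _ ≤ _ := by gcongr

/-- A small flow on a ball which starts from zero vanishes at the centre. -/
theorem exists_extinction_threshold (d : ℕ) {κ μ γ β ρ : ℝ} (hκ : 0 < κ) (hμ : 0 ≤ μ)
    (hγ : 0 < γ) (hβ : 0 ≤ β) (hd : 1 ≤ d) (hρ : 0 < ρ) :
    ∃ c : ℝ, 0 < c ∧ ∀ (T : ℝ) (O : Set (EuclideanSpace ℝ (Fin d)))
      (V S : EuclideanSpace ℝ (Fin d) → ℝ → ℝ) (x₁ : EuclideanSpace ℝ (Fin d)), 0 < T →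
      DegenerateFlow κ μ γ β T O V S → closedBall x₁ ρ ⊆ O →
      (∀ x ∈ closedBall x₁ ρ, ∀ t ∈ Icc 0 T, V x t ≤ c * T ^ (-(1 / (γ + β)))) →
      ∀ t ∈ Icc 0 T, V x₁ t = 0 := by
  have hσ : 0 < γ + β := by linarith
  obtain ⟨m, hm⟩ : ∃ m : ℕ, β + 2 ≤ 2 * (m + 1) * (γ + β) := by
    obtain ⟨m, hm⟩ := exists_nat_ge ((β + 2) / (2 * (γ + β)))
    refine ⟨m, ?_⟩
    rw [div_le_iff₀ (by positivity)] at hm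
    nlinarith
  have hd' : (1 : ℝ) ≤ d := by exact_mod_cast hd
  obtain ⟨K, hK⟩ : ∃ K, K = (ρ + 1) ^ (2 * (m + 1) * (γ + β) - (β + 2)) * (2 * (m + 1)) ^ β *
      (κ * (d * (2 * (m + 1 + 9 * 3 ^ (m + 1)))) + μ * (2 * (m + 1) * (ρ + 1))) := ⟨_, rfl⟩
  have hKpos : 0 < K := by rw [hK]; positivity
  -- This `b` makes `g` solve `g' = 2K g^(1+γ+β)`, twice the rate a touching flow can attain. The
  -- blow-up time `2T` keeps `g` finite on `[0,T]` and at least `(2bT)^(-1/(γ+β))`.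
  set b : ℝ := 2 * K * (γ + β) with hb
  have hbpos : 0 < b := by positivity
  refine ⟨(ρ ^ 2) ^ (m + 1) * (2 * b) ^ (-(1 / (γ + β))), by positivity, ?_⟩
  intro T O V S x₁ hT hV hO hbound
  set g : ℝ → ℝ := fun t => (b * (2 * T - t)) ^ (-(1 / (γ + β))) with hg
  have hbase : ∀ t ≤ T, 0 < b * (2 * T - t) := fun t ht => mul_pos hbpos (by linarith)
  have hgpos : ∀ t ≤ T, 0 < g t := fun t ht => Real.rpow_pos_of_pos (hbase t ht) _
  have hgd : ∀ t ≤ T, HasDerivAt g (2 * K * g t ^ (1 + (γ + β))) t := by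
    intro t ht
    have h1 : HasDerivAt (fun t => b * (2 * T - t)) (-b) t := by
      simpa using ((hasDerivAt_id t).const_sub (2 * T)).const_mul b
    have h2 := h1.rpow_const (p := -(1 / (γ + β))) (Or.inl (hbase t ht).ne')
    refine h2.congr_deriv ?_
    rw [hg, ← Real.rpow_mul (hbase t ht).le,
      show -(1 / (γ + β)) * (1 + (γ + β)) = -(1 / (γ + β)) - 1 by field_simp; ring, hb]
    field_simp
  have hg0 : ∀ t ∈ Icc 0 T, (2 * b) ^ (-(1 / (γ + β))) * T ^ (-(1 / (γ + β))) ≤ g t := by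
    intro t ht
    rw [← Real.mul_rpow (by positivity) hT.le]
    refine Real.rpow_le_rpow_of_nonpos (hbase t ht.2) (by nlinarith [ht.1]) ?_
    rw [neg_nonpos]; positivity
  have hstrict : ∀ ε : ℝ, 0 < ε → ε ≤ 1 → ∀ x ∈ closedBall x₁ ρ, ∀ t ∈ Icc 0 T,
      V x t < g t * (‖x - x₁‖ ^ 2 + ε) ^ (m + 1) := by
    intro ε hε hε1
    set ψ : EuclideanSpace ℝ (Fin d) × ℝ → ℝ := fun w =>
      g w.2 * (‖w.1 - x₁‖ ^ 2 + ε) ^ (m + 1) with hψ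
    have hψpos : ∀ x, ∀ t ≤ T, 0 < ψ (x, t) := fun x t ht => by
      have := hgpos t ht
      simp only [hψ]; positivity
    have hgc : ContinuousOn g (Iic T) := fun t ht =>
      (hgd t ht).continuousAt.continuousWithinAt
    have hψc : ContinuousOn ψ (closedBall x₁ ρ ×ˢ Icc 0 T) :=
      (hgc.comp continuousOn_snd fun w hw => hw.2.2).mul (by fun_prop)
    set N : Set (EuclideanSpace ℝ (Fin d) × ℝ) := (closedBall x₁ ρ ×ˢ Icc 0 T) ∩
      (fun w => V w.1 w.2 - ψ w) ⁻¹' Ici 0 with hN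
    have hNc : IsCompact N := by
      have hK' := (isCompact_closedBall x₁ ρ).prod (isCompact_Icc (a := (0 : ℝ)) (b := T))
      exact hK'.of_isClosed_subset ((hV.continuous.continuousOn.sub
        hψc).preimage_isClosed_of_isClosed hK'.isClosed isClosed_Ici) inter_subset_left
    by_contra! hcon
    obtain ⟨x, hx, t, ht, hxt⟩ := hcon
    -- Minimising the time coordinate selects the first instant at which `V` reaches the barrier.
    obtain ⟨⟨y, s⟩, ⟨⟨hy, hs⟩, hys⟩, hmin⟩ := hNc.exists_isMinOn
      ⟨(x, t), ⟨⟨hx, ht⟩, sub_nonneg.2 hxt⟩⟩ continuous_snd.continuousOn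
    have hys' : ψ (y, s) ≤ V y s := sub_nonneg.1 hys
    simp only at hy hs
    have hs0 : 0 < s := by
      refine lt_of_le_of_ne hs.1 ?_
      rintro rfl
      rw [hV.initial y (hO hy)] at hys'
      exact (hψpos y 0 hT.le).not_ge hys'
    have hbefore : ∀ x ∈ closedBall x₁ ρ, ∀ s' ∈ Ico 0 s, V x s' < ψ (x, s') := by
      intro x hx s' hs'
      by_contra! hle
      have hmem : (x, s') ∈ N := ⟨⟨hx, hs'.1, hs'.2.le.trans hs.2⟩, sub_nonneg.2 hle⟩
      have := hmin hmem
      exact (not_le.2 hs'.2) this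
    have hat : ∀ x ∈ closedBall x₁ ρ, V x s ≤ ψ (x, s) := by
      intro x hx
      have h1 : Tendsto (fun s' => V x s') (𝓝[<] s) (𝓝 (V x s)) :=
        ((hV.continuous.comp (by fun_prop : Continuous fun s' : ℝ => (x, s'))).tendsto
          s).mono_left nhdsWithin_le_nhds
      have h2 : Tendsto (fun s' => ψ (x, s')) (𝓝[<] s) (𝓝 (ψ (x, s))) :=
        (((hgd s hs.2).continuousAt.mul continuousAt_const).tendsto).mono_left nhdsWithin_le_nhds
      refine le_of_tendsto_of_tendsto h1 h2 ?_
      filter_upwards [Ioo_mem_nhdsLT hs0] with s' hs'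
      exact (hbefore x hx s' ⟨hs'.1.le, hs'.2⟩).le
    have heq : V y s = ψ (y, s) := le_antisymm (hat y hy) hys'
    -- On the sphere of radius `ρ` the assumed smallness of `V` keeps it strictly below the barrier,
    -- thanks to `ε > 0`.
    have hyball : y ∈ ball x₁ ρ := by
      rw [mem_ball]
      refine lt_of_le_of_ne hy fun hyρ => ?_
      rw [dist_eq_norm] at hyρ
      have h1 := hbound y hy s hs
      have h2 : (ρ ^ 2) ^ (m + 1) * ((2 * b) ^ (-(1 / (γ + β))) * T ^ (-(1 / (γ + β)))) ≤
          (ρ ^ 2) ^ (m + 1) * g s := by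
        gcongr; exact hg0 s hs
      have h3 : (ρ ^ 2) ^ (m + 1) * g s < ψ (y, s) := by
        simp only [hψ, hyρ]
        rw [mul_comm]
        have := hgpos s hs.2
        gcongr
        linarith
      rw [mul_assoc] at h1
      linarith
    have hVpos : 0 < V y s := heq ▸ hψpos y s hs.2
    have hup := hV.deriv_le_of_touching_barrier hκ hμ hβ m hm hε hε1 hρ.le (hgpos s hs.2) (hO hy)
      (by rw [← dist_eq_norm]; exact hy) hs heq (by
        filter_upwards [isOpen_ball.mem_nhds hyball] with y' hy'
        exact hat y' (ball_subset_closedBall hy'))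
    rw [← hK] at hup
    have hψd : HasDerivAt (fun s => ψ (y, s))
        (2 * K * g s ^ (1 + (γ + β)) * (‖y - x₁‖ ^ 2 + ε) ^ (m + 1)) s :=
      (hgd s hs.2).mul_const ((‖y - x₁‖ ^ 2 + ε) ^ (m + 1))
    have hlow := le_of_hasDerivWithinAt_Iic (m := 0)
      ((hV.hasDerivWithinAt y (hO hy) s hs hVpos).sub hψd.hasDerivWithinAt) (by
        filter_upwards [Ioo_mem_nhdsLT hs0] with s' hs'
        have := hbefore y hy s' ⟨hs'.1.le, hs'.2⟩
        simp only [Pi.sub_apply]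
        linarith)
    -- At first contact the time derivative of `V` is at least that of the barrier, with factor
    -- `2K`, yet at most the same quantity with factor `K`.
    have hpos : 0 < K * g s ^ (1 + (γ + β)) * (‖y - x₁‖ ^ 2 + ε) ^ (m + 1) := by
      have := hgpos s hs.2
      positivity
    linarith
  intro t ht
  by_contra hne
  have hVpos : 0 < V x₁ t := lt_of_le_of_ne (hV.nonneg _ _) (Ne.symm hne)
  have hgt := hgpos t ht.2
  -- At the centre the barrier equals `g t * ε ^ (m + 1) ≤ g t * ε ≤ V x₁ t`, contradicting strict
  -- comparison.
  set ε : ℝ := min 1 (V x₁ t / g t) with hε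
  have hεpos : 0 < ε := lt_min one_pos (by positivity)
  have h1 := hstrict ε hεpos (min_le_left _ _) x₁ (mem_closedBall_self hρ.le) t ht
  rw [sub_self, norm_zero, zero_pow two_ne_zero, zero_add] at h1
  have h2 : ε ^ (m + 1) ≤ ε := pow_le_of_le_one hεpos.le (min_le_left _ _) (by omega)
  have h3 : g t * ε ^ (m + 1) ≤ g t * (V x₁ t / g t) := by
    gcongr
    exact h2.trans (min_le_right _ _)
  rw [mul_div_cancel₀ _ hgt.ne'] at h3
  linarith

end Barrier

/-! ### Classical solutions as degenerate flows. -/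

section Extension

open Filter Topology Module Metric

variable {d : ℕ}

open Classical in
/-- The extension of `u` by zero outside of `U` and by constants in time outside of `[0,T]`. -/
noncomputable def zeroExtension (U : Set (EuclideanSpace ℝ (Fin d))) (T : ℝ)
    (u : EuclideanSpace ℝ (Fin d) → ℝ → ℝ) : EuclideanSpace ℝ (Fin d) → ℝ → ℝ :=
  fun x t => if x ∈ U then u x (max 0 (min t T)) else 0

variable {U : Set (EuclideanSpace ℝ (Fin d))} {T : ℝ} {u : EuclideanSpace ℝ (Fin d) → ℝ → ℝ}

theorem zeroExtension_of_notMem {x : EuclideanSpace ℝ (Fin d)} (hx : x ∉ U) (t : ℝ) :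
    zeroExtension U T u x t = 0 := if_neg hx

theorem zeroExtension_of_mem {x : EuclideanSpace ℝ (Fin d)} (hx : x ∈ U) {t : ℝ}
    (ht : t ∈ Icc 0 T) : zeroExtension U T u x t = u x t := by
  rw [zeroExtension, if_pos hx, min_eq_left ht.2, max_eq_right ht.1]

theorem clamp_mem_Icc (hT : 0 < T) (t : ℝ) : max 0 (min t T) ∈ Icc 0 T :=
  ⟨le_max_left _ _, max_le hT.le (min_le_right _ _)⟩

variable {γ β a σ Δe R₀ : ℝ} {u₀ : EuclideanSpace ℝ (Fin d) → ℝ}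

/-- The boundary condition is prescribed only for `0 < t < T`; continuity carries it to both end
times. -/
theorem IsClassicalSolution.eq_zero_of_mem_frontier
    (hu : IsClassicalSolution γ β a σ Δe U T u₀ u) (hT : 0 < T)
    {x : EuclideanSpace ℝ (Fin d)} (hx : x ∈ frontier U) {t : ℝ} (ht : t ∈ Icc 0 T) :
    u x t = 0 := by
  have hc : ContinuousOn (u x) (Icc 0 T) :=
    hu.regular.continuousOn_closure.comp (by fun_prop : Continuous fun t : ℝ => (x, t)).continuousOn
      fun s hs => ⟨frontier_subset_closure hx, hs⟩
  have h : EqOn (u x) (fun _ => 0) (Ioo 0 T) := fun s hs => hu.boundary x hx s hs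
  exact h.of_subset_closure hc continuousOn_const Ioo_subset_Icc_self
    (closure_Ioo hT.ne).superset ht

theorem IsClassicalSolution.continuous_zeroExtension
    (hu : IsClassicalSolution γ β a σ Δe U T u₀ u) (hT : 0 < T) :
    Continuous fun z : EuclideanSpace ℝ (Fin d) × ℝ => zeroExtension U T u z.1 z.2 := by
  classical
  have hset : {z : EuclideanSpace ℝ (Fin d) × ℝ | z.1 ∈ U} = U ×ˢ univ := by ext; simp
  have hcont : Continuous fun z : EuclideanSpace ℝ (Fin d) × ℝ =>
      if z.1 ∈ U then u z.1 (max 0 (min z.2 T)) else 0 := by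
    refine continuous_if (fun z hz => ?_) ?_ continuousOn_const
    · rw [hset, frontier_prod_univ_eq] at hz
      exact hu.eq_zero_of_mem_frontier hT hz.1 (clamp_mem_Icc hT _)
    · rw [hset, closure_prod_eq]
      exact hu.regular.continuousOn_closure.comp (by fun_prop : Continuous fun
        z : EuclideanSpace ℝ (Fin d) × ℝ => (z.1, max 0 (min z.2 T))).continuousOn
        fun z hz => ⟨hz.1, clamp_mem_Icc hT _⟩
  convert hcont using 2
  rw [zeroExtension]

/-- Positivity of the extension on `‖x‖ ≥ R₀` forces `x ∈ U` and `t > 0`, so the equation is used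
only where it holds. The drift is controlled by `|∑ ∂u/∂xᵢ| ≤ d |∇u|`, whence `μ = |Δe| d / a`. -/
theorem IsClassicalSolution.degenerateFlow (hu : IsClassicalSolution γ β a σ Δe U T u₀ u)
    (hU : IsOpen U) (hT : 0 < T) (ha : 0 < a) (hu₀ : Function.support u₀ ⊆ ball 0 R₀) :
    DegenerateFlow (σ ^ 2 / (2 * a)) (|Δe| / a * d) γ β T {x | R₀ ≤ ‖x‖}
      (zeroExtension U T u) (fun x t => derivWithin (u x) (Ioc 0 T) t) := by
  have hinit : ∀ x : EuclideanSpace ℝ (Fin d), R₀ ≤ ‖x‖ → zeroExtension U T u x 0 = 0 := by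
    intro x hx
    by_cases hxU : x ∈ U
    · rw [zeroExtension_of_mem hxU ⟨le_rfl, hT.le⟩, hu.initial x hxU]
      by_contra hne
      have := hu₀ (Function.mem_support.2 hne)
      rw [mem_ball_zero_iff] at this
      linarith
    · exact zeroExtension_of_notMem hxU 0
  have hmem : ∀ x : EuclideanSpace ℝ (Fin d), R₀ ≤ ‖x‖ → ∀ t ∈ Icc 0 T,
      0 < zeroExtension U T u x t → x ∈ U ∧ t ∈ Ioc 0 T := by
    intro x hx t ht hpos
    refine ⟨?_, lt_of_le_of_ne ht.1 ?_, ht.2⟩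
    · by_contra hxU
      rw [zeroExtension_of_notMem hxU] at hpos
      exact lt_irrefl _ hpos
    · rintro rfl
      rw [hinit x hx] at hpos
      exact lt_irrefl _ hpos
  have hev : ∀ x ∈ U, ∀ t ∈ Icc 0 T,
      (fun y => zeroExtension U T u y t) =ᶠ[𝓝 x] fun y => u y t := by
    intro x hx t ht
    filter_upwards [hU.mem_nhds hx] with y hy using zeroExtension_of_mem hy ht
  refine ⟨hu.continuous_zeroExtension hT, ?_, fun x hx => hinit x hx, ?_, ?_, ?_, ?_⟩
  · intro x t
    rw [zeroExtension]
    split_ifs with hx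
    · exact hu.nonneg x hx _ (clamp_mem_Icc hT t)
    · exact le_rfl
  · intro x hx t ht hpos
    obtain ⟨hxU, ht'⟩ := hmem x hx t ht hpos
    exact ((hu.regular.contDiffOn_space t ht').contDiffAt (hU.mem_nhds hxU)).congr_of_eventuallyEq
      (hev x hxU t ht)
  · intro x hx t ht hpos
    obtain ⟨hxU, ht'⟩ := hmem x hx t ht hpos
    have h1 := (hu.regular.differentiableOn_time x hxU t ht').hasDerivWithinAt
    have hnhds : Ioc 0 T ∈ 𝓝[Iic t] t := by
      filter_upwards [Ioc_mem_nhdsLE ht'.1] with s hs using ⟨hs.1, hs.2.trans ht.2⟩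
    refine (h1.mono_of_mem_nhdsWithin hnhds).congr_of_eventuallyEq ?_
      (zeroExtension_of_mem hxU ht)
    filter_upwards [hnhds] with s hs using zeroExtension_of_mem hxU ⟨hs.1.le, hs.2⟩
  · refine hu.regular.continuousOn_derivWithin_time.mono ?_
    rintro ⟨x, t⟩ ⟨hx, ht, hpos⟩
    exact hmem x hx t ht hpos
  · intro x hx t ht hpos
    obtain ⟨hxU, ht'⟩ := hmem x hx t ht hpos
    rw [(hev x hxU t ht).gradient_eq,
      (InnerProductSpace.laplacian_congr_nhds (hev x hxU t ht)).eq_of_nhds,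
      zeroExtension_of_mem hxU ht]
    have heq := hu.equation x hxU t ht'
    set f : EuclideanSpace ℝ (Fin d) → ℝ := fun y => u y t with hf
    have hu0 := hu.nonneg x hxU t ht
    set s : ℝ := ∑ i : Fin d, fderiv ℝ f x (EuclideanSpace.single i 1) with hs
    have hsum : |s| ≤ d * ‖gradient f x‖ := by
      calc |s| ≤ ∑ i : Fin d, |fderiv ℝ f x (EuclideanSpace.single i 1)| :=
            Finset.abs_sum_le_sum_abs _ _
        _ ≤ ∑ _i : Fin d, ‖gradient f x‖ := by
            refine Finset.sum_le_sum fun i _ => ?_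
            rw [← inner_gradient_left]
            simpa using abs_real_inner_le_norm (gradient f x) (EuclideanSpace.single i 1)
        _ = _ := by simp
    have h2 : derivWithin (u x) (Ioc 0 T) t - σ ^ 2 / (2 * a) * u x t ^ γ * ‖gradient f x‖ ^ β *
        Laplacian.laplacian f x = -(Δe / a * u x t ^ γ * ‖gradient f x‖ ^ β * s) := by linarith
    have hw : 0 ≤ u x t ^ γ * ‖gradient f x‖ ^ β := by positivity
    rw [h2, abs_neg, mul_assoc (Δe / a), abs_mul, abs_mul, abs_div, abs_of_pos ha, abs_of_nonneg hw]
    calc |Δe| / a * (u x t ^ γ * ‖gradient f x‖ ^ β) * |s|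
        ≤ |Δe| / a * (u x t ^ γ * ‖gradient f x‖ ^ β) * (d * ‖gradient f x‖) := by gcongr
      _ = _ := by ring

end Extension

/-! ### From integral bounds to pointwise bounds. -/

section SupBound

open Filter Topology Module Metric

/-- Local sup bound: away from the initial support, an integral bound on `V^(θ+1)` controls `V`
pointwise, with a weight that degenerates at the boundary of the region. -/
theorem exists_rpow_mul_pow_le (d : ℕ) {κ μ γ β θ R : ℝ} (hd : 1 ≤ d) (hκ : 0 < κ) (hμ : 0 ≤ μ)
    (hγ : 0 < γ) (hβ : 0 ≤ β) (hθ : 0 < θ + 1) (hR : 0 < R) :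
    ∃ B : ℝ, 0 < B ∧ ∀ (T s ℓ E : ℝ) (V S : EuclideanSpace ℝ (Fin d) → ℝ → ℝ),
      DegenerateFlow κ μ γ β T {x | s ≤ ‖x‖} V S → 0 ≤ E →
      (∀ x t, ℓ ≤ ‖x‖ → V x t = 0) →
      (∀ t ∈ Ioo 0 T, ∫⁻ x in {x | s ≤ ‖x‖}, ENNReal.ofReal (V x t ^ (θ + 1)) ≤
        ENNReal.ofReal E) →
      ∀ x, s ≤ ‖x‖ → ∀ t ∈ Icc 0 T, V x t ^ (θ + 1) * min (‖x‖ - s) R ^ d ≤ B * E := by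
  -- With this exponent `(V δ^N)^(θ+1) = V^(θ+1) δ^d`, which matches the volume of a ball of radius
  -- comparable to `δ`.
  set N : ℝ := d / (θ + 1) with hN
  have hd' : (1 : ℝ) ≤ d := by exact_mod_cast hd
  have hNpos : 0 < N := by positivity
  set Q : ℝ := 2 ^ N with hQ
  have hQ1 : 1 ≤ Q := Real.one_le_rpow one_le_two hNpos.le
  have hQ0 : 0 < Q := by linarith
  set G : ℝ := growthConst d κ μ γ β R Q with hG
  have hG1 : 1 ≤ G := one_le_growthConst d hκ hμ hβ hR.le hQ0.le
  set ω : ℝ := (volume (closedBall (0 : EuclideanSpace ℝ (Fin d)) 1)).toReal with hω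
  have hωt : volume (closedBall (0 : EuclideanSpace ℝ (Fin d)) 1) ≠ ∞ :=
    measure_closedBall_lt_top.ne
  have hωpos : 0 < ω :=
    ENNReal.toReal_pos (measure_closedBall_pos volume _ one_pos).ne' hωt
  refine ⟨2 * G ^ d * (16 * Q) ^ d * 2 ^ (θ + 1) / ω, by positivity, ?_⟩
  intro T s ℓ E V S hV hE hsupp hmass x hx t ht
  set δ : EuclideanSpace ℝ (Fin d) → ℝ := fun x => min (‖x‖ - s) R with hδ
  have hδc : Continuous δ := by fun_prop
  have hδ0 : ∀ x : EuclideanSpace ℝ (Fin d), s ≤ ‖x‖ → 0 ≤ δ x := fun x hx =>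
    le_min (by linarith) hR.le
  have hpow : ∀ x : EuclideanSpace ℝ (Fin d), s ≤ ‖x‖ → ∀ t,
      (V x t * δ x ^ N) ^ (θ + 1) = V x t ^ (θ + 1) * δ x ^ d := by
    intro x hx t
    rw [Real.mul_rpow (hV.nonneg x t) (Real.rpow_nonneg (hδ0 x hx) _), ← Real.rpow_mul (hδ0 x hx),
      hN, div_mul_cancel₀ _ hθ.ne', Real.rpow_natCast]
  rw [← hpow x hx t]
  have hVδ := mul_nonneg (hV.nonneg x t) (Real.rpow_nonneg (hδ0 x hx) N)
  rcases hVδ.eq_or_lt with h0 | hposx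
  · rw [← h0, Real.zero_rpow hθ.ne']; positivity
  set K : Set (EuclideanSpace ℝ (Fin d) × ℝ) :=
    (closedBall 0 ℓ ∩ {x | s ≤ ‖x‖}) ×ˢ Icc 0 T with hK
  have hKc : IsCompact K := ((isCompact_closedBall _ _).inter_right
    (isClosed_le continuous_const continuous_norm)).prod isCompact_Icc
  have hmemK : ∀ x : EuclideanSpace ℝ (Fin d), s ≤ ‖x‖ → ∀ t ∈ Icc 0 T, V x t ≠ 0 →
      (x, t) ∈ K := by
    intro x hx t ht hne
    refine ⟨⟨?_, hx⟩, ht⟩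
    rw [mem_closedBall_zero_iff]
    by_contra! hlt
    exact hne (hsupp x t hlt.le)
  have hWc : Continuous fun w : EuclideanSpace ℝ (Fin d) × ℝ => V w.1 w.2 * δ w.1 ^ N :=
    hV.continuous.mul ((hδc.comp continuous_fst).rpow_const fun _ => Or.inr hNpos.le)
  obtain ⟨⟨x₀, t₀⟩, hx₀K, hmax⟩ := hKc.exists_isMaxOn
    ⟨(x, t), hmemK x hx t ht fun h => by simp [h] at hposx⟩ hWc.continuousOn
  obtain ⟨⟨-, hx₀s⟩, ht₀⟩ := hx₀K
  simp only [mem_ofPred_eq] at hx₀s ht₀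
  have hmax' : ∀ x : EuclideanSpace ℝ (Fin d), s ≤ ‖x‖ → ∀ t ∈ Icc 0 T,
      V x t * δ x ^ N ≤ V x₀ t₀ * δ x₀ ^ N := by
    intro x hx t ht
    by_cases h : V x t = 0
    · rw [h, zero_mul]
      exact mul_nonneg (hV.nonneg _ _) (Real.rpow_nonneg (hδ0 x₀ hx₀s) _)
    · exact hmax (hmemK x hx t ht h)
  have hpos₀ : 0 < V x₀ t₀ * δ x₀ ^ N := hposx.trans_le (hmax' x hx t ht)
  set h : ℝ := V x₀ t₀ with hh
  have hhpos : 0 < h := lt_of_le_of_ne (hV.nonneg _ _) fun h0 => by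
    rw [← h0, zero_mul] at hpos₀
    exact lt_irrefl _ hpos₀
  have hδpos : 0 < δ x₀ := lt_of_le_of_ne (hδ0 x₀ hx₀s) fun h0 => by
    rw [← h0, Real.zero_rpow hNpos.ne', mul_zero] at hpos₀
    exact lt_irrefl _ hpos₀
  set ρ : ℝ := δ x₀ / 2 with hρ
  have hρpos : 0 < ρ := by positivity
  have hδR : δ x₀ ≤ R := min_le_right _ _
  have hδs : δ x₀ ≤ ‖x₀‖ - s := min_le_left _ _
  have hnorm : ∀ y ∈ closedBall x₀ ρ, s + ρ ≤ ‖y‖ := by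
    intro y hy
    rw [mem_closedBall, dist_comm, dist_eq_norm] at hy
    have := norm_sub_norm_le x₀ y
    linarith
  have hball : closedBall x₀ ρ ⊆ {x : EuclideanSpace ℝ (Fin d) | s ≤ ‖x‖} := fun y hy => by
    have := hnorm y hy
    simp only [mem_ofPred_eq]
    linarith
  -- On the ball `δ` is at least half of `δ x₀`, so maximality of `V δ^N` costs only the factor `Q =
  -- 2^N`, at all times at once.
  have hle : ∀ y ∈ closedBall x₀ ρ, ∀ t ∈ Icc 0 T, V y t ≤ Q * h := by
    intro y hy t ht
    have h1 := hmax' y (hball hy) t ht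
    have h2 : ρ ≤ δ y := le_min (by linarith [hnorm y hy]) (by linarith)
    have h3 : ρ ^ N ≤ δ y ^ N := Real.rpow_le_rpow hρpos.le h2 hNpos.le
    have h4 : δ x₀ ^ N = Q * ρ ^ N := by
      rw [hQ, ← Real.mul_rpow (by norm_num) hρpos.le]; congr 1; rw [hρ]; ring
    have h5 : V y t * ρ ^ N ≤ (Q * h) * ρ ^ N := by
      calc V y t * ρ ^ N ≤ V y t * δ y ^ N := by
            gcongr
            exact hV.nonneg y t
        _ ≤ h * δ x₀ ^ N := h1
        _ = _ := by rw [h4]; ring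
    exact le_of_mul_le_mul_right h5 (by positivity)
  set k : ℝ := (h / 2) ^ (θ + 1) with hk
  have hkpos : 0 < k := by positivity
  -- Chebyshev's inequality for `V^(θ+1)`.
  have hm : ∀ t ∈ Ioo 0 T, volume {y ∈ closedBall x₀ ρ | h / 2 ≤ V y t} ≤
      ENNReal.ofReal (E / k) := by
    intro t ht
    have hVt : Continuous fun y => V y t :=
      hV.continuous.comp (by fun_prop : Continuous fun y => (y, t))
    have hmeas : MeasurableSet {y ∈ closedBall x₀ ρ | h / 2 ≤ V y t} :=
      (isClosed_closedBall.inter (isClosed_le continuous_const hVt)).measurableSet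
    rw [ENNReal.ofReal_div_of_pos hkpos, ENNReal.le_div_iff_mul_le (Or.inl (by simpa using hkpos))
      (Or.inl ENNReal.ofReal_ne_top), mul_comm, ← setLIntegral_const]
    refine (setLIntegral_mono' hmeas fun y hy => ?_).trans
      ((lintegral_mono_set fun y hy => hball hy.1).trans (hmass t ht))
    refine ENNReal.ofReal_le_ofReal ?_
    exact Real.rpow_le_rpow (by positivity) hy.2 hθ.le
  have hgrow := hV.volume_closedBall_le hd hκ hμ hβ hγ hhpos hQ1 hρpos
    (show ρ ≤ R by linarith) hball ht₀ hh.symm hle hm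
  rw [Measure.addHaar_closedBall' _ _ (by positivity), ← ENNReal.ofReal_toReal hωt,
    ← ENNReal.ofReal_mul (by positivity), ← ENNReal.ofReal_mul (by positivity),
    show (2 : ℝ≥0∞) * ENNReal.ofReal (growthConst d κ μ γ β R Q ^ d * (E / k)) =
      ENNReal.ofReal (2 * (growthConst d κ μ γ β R Q ^ d * (E / k))) by
      rw [ENNReal.ofReal_mul zero_le_two, ENNReal.ofReal_ofNat],
    ENNReal.ofReal_le_ofReal_iff (by positivity), finrank_euclideanSpace_fin, ← hω, ← hG] at hgrow
  have hfinal : (V x₀ t₀ * δ x₀ ^ N) ^ (θ + 1) ≤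
      2 * G ^ d * (16 * Q) ^ d * 2 ^ (θ + 1) / ω * E := by
    rw [hpow x₀ hx₀s t₀, ← hh]
    have hkh : h ^ (θ + 1) = k * 2 ^ (θ + 1) := by
      rw [hk, ← Real.mul_rpow (by positivity) (by norm_num)]; congr 1; ring
    have hδρ : δ x₀ ^ d = (ρ / (8 * Q)) ^ d * (16 * Q) ^ d := by
      rw [← mul_pow]; congr 1; rw [hρ]; field_simp; norm_num
    calc h ^ (θ + 1) * δ x₀ ^ d
        = ((ρ / (8 * Q)) ^ d * ω) * (k * (16 * Q) ^ d * 2 ^ (θ + 1) / ω) := by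
          rw [hkh, hδρ]; field_simp
      _ ≤ (2 * (G ^ d * (E / k))) * (k * (16 * Q) ^ d * 2 ^ (θ + 1) / ω) := by gcongr
      _ = _ := by field_simp
  exact (Real.rpow_le_rpow hposx.le (hmax' x hx t ht) hθ.le).trans hfinal

end SupBound

/-! ### The localization threshold. -/

section FinitePropagation

open Metric

theorem DegenerateFlow.mono {d : ℕ} {κ μ γ β T : ℝ} {O O' : Set (EuclideanSpace ℝ (Fin d))}
    {V S : EuclideanSpace ℝ (Fin d) → ℝ → ℝ} (hV : DegenerateFlow κ μ γ β T O V S)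
    (hO : O' ⊆ O) : DegenerateFlow κ μ γ β T O' V S where
  continuous := hV.continuous
  nonneg := hV.nonneg
  initial x hx := hV.initial x (hO hx)
  contDiffAt x hx := hV.contDiffAt x (hO hx)
  hasDerivWithinAt x hx := hV.hasDerivWithinAt x (hO hx)
  continuousOn_deriv := hV.continuousOn_deriv.mono fun _ hz => ⟨hO hz.1, hz.2⟩
  equation x hx := hV.equation x (hO hx)

theorem epsZero_pos {d : ℕ} {γ β θ : ℝ} (hd : 1 ≤ d) (hγ : 0 < γ) (hβ : 0 ≤ β) (hθ : 1 ≤ θ) :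
    0 < epsZero d γ β θ := by
  have hd' : (1 : ℝ) ≤ d := by exact_mod_cast hd
  refine mul_pos ?_ ?_
  · rw [zetaExp, sub_pos, div_lt_one (by positivity)]
    have : 0 < d * (β + 2) * (θ + 1) := by positivity
    linarith
  · rw [qExp, sub_pos, lt_div_iff₀ (by positivity), one_mul, div_lt_iff₀ (by linarith)]
    nlinarith

theorem wMap_rpow_qExp {d : ℕ} {γ β θ : ℝ} (hγ : 0 < γ) (hβ : 0 ≤ β) (hθ : 1 ≤ θ)
    {u : EuclideanSpace ℝ (Fin d) → ℝ → ℝ} {x : EuclideanSpace ℝ (Fin d)} {t : ℝ}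
    (hu : 0 ≤ u x t) : wMap γ β θ u x t ^ qExp γ β θ = u x t ^ (θ + 1) := by
  have h : 0 < θ + γ + β + 1 := by linarith
  rw [wMap, qExp, ← Real.rpow_mul hu]
  congr 1
  field_simp

variable {d : ℕ} {γ β θ a σ Δe R₀ T r : ℝ} {U : Set (EuclideanSpace ℝ (Fin d))}
  {u₀ : EuclideanSpace ℝ (Fin d) → ℝ} {u : EuclideanSpace ℝ (Fin d) → ℝ → ℝ}

theorem IsClassicalSolution.lintegral_zeroExtension_le_energy
    (hu : IsClassicalSolution γ β a σ Δe U T u₀ u) (hU : IsOpen U) (hγ : 0 < γ) (hβ : 0 ≤ β)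
    (hθ : 1 ≤ θ) {t : ℝ} (ht : t ∈ Ioo 0 T) :
    ∫⁻ x in {x | 3 / 2 * r ≤ ‖x‖}, ENNReal.ofReal (zeroExtension U T u x t ^ (θ + 1)) ≤
      energy γ β θ U r u 0 T := by
  have ht' : t ∈ Icc 0 T := Ioo_subset_Icc_self ht
  -- The energy of index `0` lives on the set of index `1`, whose radius is `2r (1 - 1/4) = 3r/2`.
  have hset : outer U r (0 + 1) = U ∩ {x | 3 / 2 * r ≤ ‖x‖} := by
    ext x
    rw [outer, radius]
    simp only [mem_sdiff, mem_ball_zero_iff, not_lt, mem_inter_iff, mem_ofPred_eq]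
    norm_num
    intro _
    rw [show 2 * r * (3 / 4) = 3 / 2 * r by ring]
  calc ∫⁻ x in {x | 3 / 2 * r ≤ ‖x‖}, ENNReal.ofReal (zeroExtension U T u x t ^ (θ + 1))
      = ∫⁻ x in {x | 3 / 2 * r ≤ ‖x‖},
          U.indicator (fun x => ENNReal.ofReal (wMap γ β θ u x t ^ qExp γ β θ)) x := by
        refine lintegral_congr fun x => ?_
        by_cases hx : x ∈ U
        · rw [indicator_of_mem hx, zeroExtension_of_mem hx ht',
            wMap_rpow_qExp hγ hβ hθ (hu.nonneg x hx t ht')]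
        · rw [indicator_of_notMem hx, zeroExtension_of_notMem hx,
            Real.zero_rpow (by linarith), ENNReal.ofReal_zero]
    _ = ∫⁻ x in outer U r (0 + 1), ENNReal.ofReal (wMap γ β θ u x t ^ qExp γ β θ) := by
        rw [setLIntegral_indicator hU.measurableSet, hset]
    _ ≤ ⨆ τ ∈ Ioo 0 T, ∫⁻ x in outer U r (0 + 1),
          ENNReal.ofReal (wMap γ β θ u x τ ^ qExp γ β θ) :=
        le_iSup₂ (f := fun τ (_ : τ ∈ Ioo 0 T) => ∫⁻ x in outer U r (0 + 1),
          ENNReal.ofReal (wMap γ β θ u x τ ^ qExp γ β θ)) t ht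
    _ ≤ _ := le_self_add

/-- If the energy outside of the ball of radius `3r/2` is below a threshold which depends only on
the structural constants and scales like `T^(-(θ+1)/(γ+β))`, then `u` vanishes outside of the ball
of radius `2r`. -/
theorem exists_localization_threshold (d : ℕ) {γ β θ a σ Δe R₀ : ℝ} (hd : 1 ≤ d) (hγ : 0 < γ)
    (hβ : 0 ≤ β) (hθ : 1 ≤ θ) (ha : 0 < a) (hσ : 0 < σ ^ 2) (hR₀ : 0 < R₀) :
    ∃ K : ℝ, 0 < K ∧ ∀ (U : Set (EuclideanSpace ℝ (Fin d))) (T r : ℝ)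
      (u₀ : EuclideanSpace ℝ (Fin d) → ℝ) (u : EuclideanSpace ℝ (Fin d) → ℝ → ℝ),
      IsOpen U → Bornology.IsBounded U → 0 < T → 2 * R₀ < r →
      Function.support u₀ ⊆ ball 0 R₀ → IsClassicalSolution γ β a σ Δe U T u₀ u →
      energy γ β θ U r u 0 T ≤ ENNReal.ofReal (K * T ^ (-((θ + 1) / (γ + β)))) →
      ∀ t ∈ Icc 0 T, ∀ x ∈ U, 2 * r ≤ ‖x‖ → u x t = 0 := by
  have hκ : 0 < σ ^ 2 / (2 * a) := by positivity
  have hμ : 0 ≤ |Δe| / a * d := by positivity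
  have hθ1 : 0 < θ + 1 := by linarith
  obtain ⟨B, hB, hsup⟩ := exists_rpow_mul_pow_le d hd hκ hμ hγ hβ hθ1 hR₀
  obtain ⟨c, hc, hext⟩ := exists_extinction_threshold d hκ hμ hγ hβ hd (half_pos hR₀)
  -- Chosen so that the sup bound, where the weight is at least `R₀ / 2`, yields exactly the
  -- smallness `c T^(-1/(γ+β))` required for extinction on balls of radius `R₀ / 2`.
  refine ⟨c ^ (θ + 1) * (R₀ / 2) ^ d / B, by positivity, ?_⟩
  intro U T r u₀ u hU hbdd hT hr hu₀ hu henergy t ht x₁ hx₁U hx₁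
  have hflow := hu.degenerateFlow hU hT ha hu₀
  obtain ⟨ℓ, hℓ⟩ := hbdd.subset_ball 0
  have hbound : ∀ x : EuclideanSpace ℝ (Fin d), 3 / 2 * r + R₀ / 2 ≤ ‖x‖ → ∀ t ∈ Icc 0 T,
      zeroExtension U T u x t ≤ c * T ^ (-(1 / (γ + β))) := by
    intro x hx t ht
    have h1 := hsup T (3 / 2 * r) ℓ (c ^ (θ + 1) * (R₀ / 2) ^ d / B * T ^ (-((θ + 1) / (γ + β))))
      (zeroExtension U T u) _ (hflow.mono fun x hx => by
        simp only [mem_ofPred_eq] at hx ⊢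
        linarith)
      (by positivity)
      (fun x t hx => zeroExtension_of_notMem (fun hxU => by
        have := hℓ hxU
        rw [mem_ball_zero_iff] at this
        linarith) t)
      (fun t ht => (hu.lintegral_zeroExtension_le_energy hU hγ hβ hθ ht).trans henergy)
      x (by linarith) t ht
    have hV0 := hflow.nonneg x t
    have h2 : zeroExtension U T u x t ^ (θ + 1) * (R₀ / 2) ^ d ≤
        (c * T ^ (-(1 / (γ + β)))) ^ (θ + 1) * (R₀ / 2) ^ d := by
      calc _ ≤ zeroExtension U T u x t ^ (θ + 1) * min (‖x‖ - 3 / 2 * r) R₀ ^ d := by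
            gcongr
            exact le_min (by linarith) (by linarith)
        _ ≤ _ := h1
        _ = c ^ (θ + 1) * T ^ (-((θ + 1) / (γ + β))) * (R₀ / 2) ^ d := by field_simp
        _ = _ := by
            rw [Real.mul_rpow hc.le (by positivity), ← Real.rpow_mul hT.le]
            congr 3; ring
    have h3 := le_of_mul_le_mul_right h2 (by positivity)
    exact (Real.rpow_le_rpow_iff hV0 (by positivity) hθ1).1 h3
  -- Because `r > 2 R₀`, one has `2r - R₀/2 ≥ 3r/2 + R₀/2`, so the whole ball lies where `hbound`
  -- applies.
  have hnorm : ∀ x ∈ closedBall x₁ (R₀ / 2), 2 * r - R₀ / 2 ≤ ‖x‖ := by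
    intro x hx
    rw [mem_closedBall, dist_comm, dist_eq_norm] at hx
    have := norm_sub_norm_le x₁ x
    linarith
  have h := hext T _ _ _ x₁ hT hflow (fun x hx => by
      have := hnorm x hx
      simp only [mem_ofPred_eq]
      linarith)
    (fun x hx => hbound x (by have := hnorm x hx; linarith)) t ht
  rwa [zeroExtension_of_mem hx₁U ht] at h

end FinitePropagation

end Localization

/-! ### Choice of `C_L` and conclusion. -/

theorem mainTheorem1 (d : ℕ) (hd : 1 ≤ d) (γ β θ p a σ Δe R₀ : ℝ)
    (hγ : 0 < γ) (hβ : 0 ≤ β) (hθ : 1 ≤ θ) (ha : 0 < a) (hσ : 0 < σ ^ 2) (hR₀ : 0 < R₀)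
    (hp₁ : β + 2 ≤ p) (hp₂ : p < (θ + γ) / (β + 1) - 2 * |Δe| / σ ^ 2) :
    ∃ C_L : ℝ, 0 < C_L ∧
      ∀ (U : Set (EuclideanSpace ℝ (Fin d))) (T r : ℝ)
        (u₀ : EuclideanSpace ℝ (Fin d) → ℝ) (u : EuclideanSpace ℝ (Fin d) → ℝ → ℝ),
        IsOpen U → Bornology.IsBounded U → 0 < T → 2 * R₀ < r →
        Function.support u₀ ⊆ Metric.ball 0 R₀ →
        Localization.IsClassicalSolution γ β a σ Δe U T u₀ u →
        Localization.energy γ β θ U r u 0 T ≤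
          ENNReal.ofReal (C_L ^ (-(1 / Localization.epsZero d γ β θ))
            * 2 ^ (-((β + 2) / Localization.epsZero d γ β θ ^ 2))
            * T ^ (-((θ + 1) / (γ + β)))) →
        ∀ t ∈ Icc 0 T,
          (∀ᵐ x ∂(volume.restrict (⋂ n : ℕ, Localization.outer U r n)),
            Localization.wMap γ β θ u x t = 0) ∧
          (∀ᵐ x ∂(volume.restrict (U \ Metric.ball 0 (2 * r))), u x t = 0) := by
  obtain ⟨K, hK, hmain⟩ :=
    Localization.exists_localization_threshold d (Δe := Δe) hd hγ hβ hθ ha hσ hR₀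
  have hε := Localization.epsZero_pos hd hγ hβ hθ
  set ε := Localization.epsZero d γ β θ with hεdef
  -- Then `C_L ^ (-1/ε₀) = K`, and the remaining power of `2` is at most `1`, so the hypothesis
  -- implies the threshold condition.
  refine ⟨K ^ (-ε), by positivity, ?_⟩
  intro U T r u₀ u hU hbdd hT hr hu₀ hu henergy t ht
  have hKε : (K ^ (-ε)) ^ (-(1 / ε)) = K := by
    rw [← Real.rpow_mul hK.le, show -ε * -(1 / ε) = 1 by field_simp, Real.rpow_one]
  have htwo : (2 : ℝ) ^ (-((β + 2) / ε ^ 2)) ≤ 1 :=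
    Real.rpow_le_one_of_one_le_of_nonpos one_le_two (by rw [neg_nonpos]; positivity)
  have hzero := hmain U T r u₀ u hU hbdd hT hr hu₀ hu (henergy.trans (ENNReal.ofReal_le_ofReal (by
    rw [hKε]
    gcongr
    exact mul_le_of_le_one_right hK.le htwo))) t ht
  have hU' : ∀ n, MeasurableSet (Localization.outer U r n) := fun n =>
    hU.measurableSet.diff Metric.isOpen_ball.measurableSet
  refine ⟨?_, ?_⟩
  · refine ae_restrict_of_forall_mem (MeasurableSet.iInter hU') fun x hx => ?_
    rw [mem_iInter] at hx
    -- The radii increase to `2r`, so a point outside every ball satisfies the limiting inequality.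
    have hxr : 2 * r ≤ ‖x‖ := by
      have hlim : Filter.Tendsto (Localization.radius r) Filter.atTop (nhds (2 * r)) := by
        have h1 : Filter.Tendsto (fun n : ℕ => (1 / 2 : ℝ) ^ (n + 1)) Filter.atTop (nhds 0) :=
          (tendsto_pow_atTop_nhds_zero_of_lt_one (by norm_num) (by norm_num)).comp
            (Filter.tendsto_add_atTop_nat 1)
        have h2 := (h1.const_sub 1).const_mul (2 * r)
        rw [sub_zero, mul_one] at h2
        refine h2.congr fun n => ?_
        rw [Localization.radius, one_div_pow]
      refine le_of_tendsto' hlim fun n => ?_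
      have := (hx n).2
      rwa [Metric.mem_ball, dist_zero_right, not_lt] at this
    rw [Localization.wMap, hzero x (hx 0).1 hxr, Real.zero_rpow]
    have : 0 < (θ + γ + β + 1) / (β + 2) := by positivity
    exact this.ne'
  · refine ae_restrict_of_forall_mem (hU.measurableSet.diff Metric.isOpen_ball.measurableSet)
      fun x hx => hzero x hx.1 ?_
    have := hx.2
    rwa [Metric.mem_ball, dist_zero_right, not_lt] at this
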